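/- Let $G=\mathrm{SL}(2,\mathbb R)$, $\Gamma=\mathrm{SL}(2,\mathbb Z)$, $\mathbb T=\mathbb R/\mathbb Z$ and $e(x)=\mathrm e^{2\pi\mathrm i x}$. Write $M\in G$ in Iwasawa coordinates $(u+\mathrm i v,\phi)$, $v>0$, $\phi\in\mathbb R/2\pi\mathbb Z$, $$M=\begin{pmatrix}1&u\\0&1\end{pmatrix}\begin{pmatrix}v^{1/2}&0\\0&v^{-1/2}\end{pmatrix}\begin{pmatrix}\cos\phi&-\sin\phi\\ \sin\phi&\cos\phi\end{pmatrix}.$$ Let $\chi$ be the indicator function of $(0,1]$, and put $\chi_\phi(w)=\chi(w)$ if $\phi=0 \bmod 2\pi$, $\chi_\phi(w)=\chi(-w)$ if $\phi=\pi\bmod 2\pi$, and otherwise $$\chi_\phi(w)=|\sin\phi|^{-1/2}\int_{\mathbb R} e\!\left(\frac{\tfrac12(w^2+w'^2)\cos\phi-ww'}{\sin\phi}\right)\chi(w')\,dw'.$$ Consider the theta series $$\Theta_\chi(M;(x,y))=v^{1/4}\sum_{n\in\mathbb Z}\chi_\phi\big((n-y)v^{1/2}\big)\,e\big(\tfrac12(n-y)^2u+nx\big).$$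 (a) For every $M\in G$ this series converges unconditionally in $L^2([0,1)^2,dx\,dy)$. Let $\nu_M$ be the Borel probability measure on $\mathbb C$ which is the law of $e(t)\,|\Theta_\chi(M;(x,y))|$ for $(t,x,y)$ uniformly distributed in $[0,1)^3$ (a fundamental domain of $\mathbb T^3$). Then $\nu_M$ depends only on the coset $\Gamma M\in\Gamma\backslash G$. (b) With respect to the weak topology on the Borel probability measures on $\mathbb C$ (tested against bounded continuous functions), $$\overline{\{\nu_M: M\in\Gamma\backslash G\}}=\{\nu_M: M\in\Gamma\backslash G\}\cup\{\delta_0\},$$ where $\delta_0$ is the unit point mass at $0$. (c) If $(M_i)_{i\in\mathbb N}$ is a sequence in $\Gamma\backslash G$ that diverges, i.e. for every compact $K\subset\Gamma\backslash G$ there is $i_0$ such that $M_i\notin K$ for all $i\ge i_0$, then $\nu_{M_i}\to\delta_0$ weakly. -/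

import Mathlib

open MeasureTheory Filter Topology
open scoped MatrixGroups

noncomputable section

namespace ThetaLaw

/-- `e(x) = exp(2 π i x)`. -/
def e (x : ℝ) : ℂ := Complex.exp (2 * Real.pi * Complex.I * (x : ℂ))

/-! ### The group `G = SL(2,ℝ)`, the lattice `Γ = SL(2,ℤ)` and Iwasawa coordinates -/

/-- `Γ = SL(2,ℤ)` as a subgroup of `SL(2,ℝ)`. -/
def Gam : Subgroup SL(2, ℝ) :=
  (Matrix.SpecialLinearGroup.map (n := Fin 2) (Int.castRingHom ℝ)).range

/-- The space `Γ \ G` of cosets `Γ M`, with the quotient topology. -/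
abbrev ModQuot : Type := Quotient (QuotientGroup.rightRel Gam)

/-- The projection `G → Γ \ G`, `M ↦ Γ M`. -/
def toQuot (M : SL(2, ℝ)) : ModQuot := Quotient.mk _ M

/-- Iwasawa coordinate `u = Re (M · i)`. -/
def iwU (M : SL(2, ℝ)) : ℝ :=
  (M.1 0 0 * M.1 1 0 + M.1 0 1 * M.1 1 1) / (M.1 1 0 ^ 2 + M.1 1 1 ^ 2)

/-- Iwasawa coordinate `v = Im (M · i)`. -/
def iwV (M : SL(2, ℝ)) : ℝ := 1 / (M.1 1 0 ^ 2 + M.1 1 1 ^ 2)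

/-- Iwasawa coordinate `φ = arg (c i + d)`; only its class modulo `2 π` matters. -/
def iwPhi (M : SL(2, ℝ)) : ℝ := Complex.arg ⟨M.1 1 1, M.1 1 0⟩

theorem row_pos (M : SL(2, ℝ)) : 0 < M.1 1 0 ^ 2 + M.1 1 1 ^ 2 := by
  have h := M.2
  rw [Matrix.det_fin_two] at h
  by_contra hc
  have h0 : M.1 1 0 = 0 := by nlinarith [sq_nonneg (M.1 1 0), sq_nonneg (M.1 1 1)]
  have h1 : M.1 1 1 = 0 := by nlinarith [sq_nonneg (M.1 1 0), sq_nonneg (M.1 1 1)]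
  rw [h0, h1] at h
  norm_num at h

theorem iwV_pos (M : SL(2, ℝ)) : 0 < iwV M := one_div_pos.mpr (row_pos M)

/-- The coordinates above are those of the Iwasawa decomposition. -/
theorem iwasawa (M : SL(2, ℝ)) :
    M.1 = !![1, iwU M; 0, 1] * !![Real.sqrt (iwV M), 0; 0, 1 / Real.sqrt (iwV M)] *
      !![Real.cos (iwPhi M), -Real.sin (iwPhi M); Real.sin (iwPhi M), Real.cos (iwPhi M)] := by
  have hr := row_pos M
  have hdet := M.2
  rw [Matrix.det_fin_two] at hdet
  set r : ℝ := Real.sqrt (M.1 1 0 ^ 2 + M.1 1 1 ^ 2) with hrdef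
  have hr0 : 0 < r := Real.sqrt_pos.mpr hr
  have hr2 : r ^ 2 = M.1 1 0 ^ 2 + M.1 1 1 ^ 2 := Real.sq_sqrt hr.le
  have hv : Real.sqrt (iwV M) = 1 / r := by
    rw [iwV, Real.sqrt_div zero_le_one, Real.sqrt_one]
  have hnorm : ‖(⟨M.1 1 1, M.1 1 0⟩ : ℂ)‖ = r := by
    rw [Complex.norm_def, Complex.normSq_mk, hrdef]
    congr 1
    ring
  have hne : (⟨M.1 1 1, M.1 1 0⟩ : ℂ) ≠ 0 := by
    rw [← norm_pos_iff, hnorm]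
    exact hr0
  have hcos : Real.cos (iwPhi M) = M.1 1 1 / r := by
    rw [iwPhi, Complex.cos_arg hne, hnorm]
  have hsin : Real.sin (iwPhi M) = M.1 1 0 / r := by
    rw [iwPhi, Complex.sin_arg, hnorm]
  rw [hv, hcos, hsin, iwU, ← hr2]
  ext i j
  fin_cases i <;> fin_cases j <;>
    simp [Matrix.mul_apply, Fin.sum_univ_two] <;> field_simp <;>
    first
    | (rw [hr2]; linear_combination (M.1 1 1) * hdet)
    | (rw [hr2]; linear_combination (-(M.1 1 0)) * hdet)

/-! ### The theta function of the indicator function of `(0,1]` -/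

/-- The function `f_φ`. -/
def rot (f : ℝ → ℂ) (φ : ℝ) (w : ℝ) : ℂ :=
  open Classical in
  if (φ : Real.Angle) = 0 then f w
  else if (φ : Real.Angle) = (Real.pi : Real.Angle) then f (-w)
  else ((|Real.sin φ| ^ (-(1 / 2) : ℝ) : ℝ) : ℂ) *
    ∫ w' : ℝ, e (((1 / 2) * (w ^ 2 + w' ^ 2) * Real.cos φ - w * w') / Real.sin φ) * f w'

/-- The `n`-th term of the series `Θ_f(τ,φ;(x,y))`, as a function of `p = (x,y)`, where
`(τ,φ)`, `τ = u + i v`, are the Iwasawa coordinates of `M`. -/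
def thetaTerm (f : ℝ → ℂ) (M : SL(2, ℝ)) (n : ℤ) (p : ℝ × ℝ) : ℂ :=
  ((iwV M ^ (1 / 4 : ℝ) : ℝ) : ℂ) * rot f (iwPhi M) ((n - p.2) * Real.sqrt (iwV M)) *
    e ((1 / 2) * (n - p.2) ^ 2 * iwU M + n * p.1)

/-- The indicator function of `(0,1]`. -/
def chi : ℝ → ℂ := (Set.Ioc (0 : ℝ) 1).indicator fun _ => 1

/-- Lebesgue measure on the fundamental domain `[0,1)` of `𝕋 = ℝ/ℤ`. -/
def unif : Measure ℝ := volume.restrict (Set.Ico 0 1)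

instance : IsProbabilityMeasure unif := ⟨by simp [unif]⟩

theorem continuous_e : Continuous e := by
  unfold e
  fun_prop

theorem norm_e (x : ℝ) : ‖e x‖ = 1 := by
  rw [e, show 2 * (Real.pi : ℂ) * Complex.I * (x : ℂ) = ((2 * Real.pi * x : ℝ) : ℂ) * Complex.I by
    push_cast; ring]
  exact Complex.norm_exp_ofReal_mul_I _

theorem measurable_chi : Measurable chi :=
  measurable_const.indicator measurableSet_Ioc

theorem norm_chi_le (w : ℝ) : ‖chi w‖ ≤ 1 := by
  unfold chi
  by_cases h : w ∈ Set.Ioc (0 : ℝ) 1 <;> simp [h]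

theorem integral_norm_chi : ∫ w, ‖chi w‖ = 1 := by
  have : (fun w => ‖chi w‖) = (Set.Ioc (0 : ℝ) 1).indicator fun _ => (1 : ℝ) := by
    ext w
    by_cases h : w ∈ Set.Ioc (0 : ℝ) 1 <;> simp [chi, h]
  rw [this, integral_indicator measurableSet_Ioc]
  simp

theorem measurable_rot_chi (φ : ℝ) : Measurable (rot chi φ) := by
  by_cases h0 : (φ : Real.Angle) = 0
  · have : rot chi φ = chi := by ext w; simp [rot, h0]
    rw [this]
    exact measurable_chi
  by_cases h1 : (φ : Real.Angle) = (Real.pi : Real.Angle)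
  · have : rot chi φ = fun w => chi (-w) := by
      ext w; rw [rot, if_neg h0, if_pos h1]
    rw [this]
    exact measurable_chi.comp measurable_neg
  have : rot chi φ = fun w => ((|Real.sin φ| ^ (-(1 / 2) : ℝ) : ℝ) : ℂ) *
    ∫ w' : ℝ, e (((1 / 2) * (w ^ 2 + w' ^ 2) * Real.cos φ - w * w') / Real.sin φ) * chi w' := by
      ext w; simp only [rot, h0, h1, if_false]
  rw [this]
  refine Measurable.const_mul ?_ _
  refine StronglyMeasurable.measurable (StronglyMeasurable.integral_prod_right' (f := fun z : ℝ × ℝ =>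
    e (((1 / 2) * (z.1 ^ 2 + z.2 ^ 2) * Real.cos φ - z.1 * z.2) / Real.sin φ) * chi z.2) ?_)
  refine Measurable.stronglyMeasurable ?_
  refine Measurable.mul (continuous_e.measurable.comp ?_) (measurable_chi.comp measurable_snd)
  fun_prop

theorem exists_bound_rot_chi (φ : ℝ) : ∃ C : ℝ, ∀ w, ‖rot chi φ w‖ ≤ C := by
  refine ⟨max 1 ((|Real.sin φ| ^ (-(1 / 2) : ℝ) : ℝ)), fun w => ?_⟩
  unfold rot
  split_ifs
  · exact (norm_chi_le w).trans (le_max_left _ _)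
  · exact (norm_chi_le (-w)).trans (le_max_left _ _)
  · refine le_trans ?_ (le_max_right _ _)
    have hs : 0 ≤ |Real.sin φ| ^ (-(1 / 2) : ℝ) := Real.rpow_nonneg (abs_nonneg _) _
    rw [norm_mul, Complex.norm_real, Real.norm_of_nonneg hs]
    refine mul_le_of_le_one_right hs ((norm_integral_le_integral_norm _).trans ?_)
    simp only [norm_mul, norm_e, one_mul]
    exact integral_norm_chi.le

/-- Each term of the theta series of `chi` is square integrable in `(x,y)`. -/
theorem memLp_thetaTerm (M : SL(2, ℝ)) (n : ℤ) :
    MemLp (thetaTerm chi M n) 2 (unif.prod unif) := by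
  obtain ⟨C, hC⟩ := exists_bound_rot_chi (iwPhi M)
  refine MemLp.of_bound (C := iwV M ^ (1 / 4 : ℝ) * C) ?_ (Eventually.of_forall fun p => ?_)
  · refine Measurable.aestronglyMeasurable ?_
    unfold thetaTerm
    refine Measurable.mul (Measurable.const_mul ((measurable_rot_chi _).comp ?_) _)
      (continuous_e.measurable.comp ?_)
    · fun_prop
    · fun_prop
  · have hv : 0 ≤ iwV M ^ (1 / 4 : ℝ) := Real.rpow_nonneg (iwV_pos M).le _
    rw [thetaTerm, norm_mul, norm_mul, norm_e, mul_one, Complex.norm_real, Real.norm_of_nonneg hv]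
    exact mul_le_mul_of_nonneg_left (hC _) hv

/-- The `n`-th term of the theta series of `chi`, as an element of `L²(𝕋²)`. -/
def thetaTermLp (M : SL(2, ℝ)) (n : ℤ) : Lp ℂ 2 (unif.prod unif) :=
  (memLp_thetaTerm M n).toLp _

/-- `Θ_χ(M; ·)`, the sum of the theta series of `chi` in `L²(𝕋²)`. -/
def theta (M : SL(2, ℝ)) : Lp ℂ 2 (unif.prod unif) := ∑' n : ℤ, thetaTermLp M n

/-! ### The probability measures `ν_M` -/

/-- The random variable `e(t) |Θ_χ(M; ξ)|` on `𝕋³ ∋ (t, ξ)`. -/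
def thetaVar (M : SL(2, ℝ)) (z : ℝ × ℝ × ℝ) : ℂ := e z.1 * ((‖theta M z.2‖ : ℝ) : ℂ)

theorem aemeasurable_thetaVar (M : SL(2, ℝ)) :
    AEMeasurable (thetaVar M) (unif.prod (unif.prod unif)) := by
  refine Measurable.aemeasurable ?_
  unfold thetaVar
  refine Measurable.mul (continuous_e.measurable.comp measurable_fst) ?_
  exact Complex.measurable_ofReal.comp
    (((Lp.stronglyMeasurable (theta M)).measurable.comp measurable_snd).norm)

/-- `ν_M`: the law of `e(t) |Θ_χ(M; ξ)|` for `(t, ξ)` uniformly distributed in `𝕋³`. -/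
def nuG (M : SL(2, ℝ)) : ProbabilityMeasure ℂ :=
  ⟨(unif.prod (unif.prod unif)).map (thetaVar M),
    Measure.isProbabilityMeasure_map (aemeasurable_thetaVar M)⟩

/-- The point mass at `0`. -/
def delta0 : ProbabilityMeasure ℂ := ⟨Measure.dirac 0, inferInstance⟩

end ThetaLaw

end

noncomputable section

namespace ThetaLaw

/-! ### Preliminaries -/

/-! Let g = `weil M`, that is g(w) = v^{1/4} χ_φ(w v^{1/2}) e(w² u / 2). The theta series is the Zak
transform Σ g(n - y) e(nx) of g. For fixed y it is a Fourier series in x, so Parseval, together with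
cutting ℝ into unit intervals, makes the Zak transform an isometry of L²(ℝ) into L²([0,1)²)
(`SqInt.enorm_zak`). This gives unconditional convergence, and it turns L² convergence of the
functions g into weak convergence of the laws (`SqInt.tendsto_zak`, `tendsto_law`).

The law sees only the modulus of the transform, and only up to measure preserving maps of the torus
(`law_eq_of_norm_eq`). Invariance under Γ is therefore checked on two generators. Left
multiplication by T multiplies g by the chirp e(w²/2), which shears the torus (`law_zak_chirp`).
Left multiplication by S replaces g, up to a phase, by its Fourier transform, which by Poisson
summation turns the torus through a right angle (`Decay.law_zak_ft`). When the lower left entry c of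
M is nonzero, g is an oscillatory integral for which only a bound of order 1/|w| is at hand. Poisson
summation is thus applied after Gaussian damping, and the damping is removed in L² (`law_zak_ker`).

Where c ≠ 0, dominated convergence shows that the law is continuous in M; invariance under S carries
this over to c = 0 (`continuous_nuG`). As v → ∞ the L² mass of g outside any neighbourhood of 0
vanishes. If y stays away from 0 and 1, the points n - y avoid such a neighbourhood, so the Zak
transform tends to 0 in measure and the law tends to δ₀ (`tendsto_nuG_cusp`).

By reduction theory the cosets with a Siegel representative of bounded v lie in a compact set, so
divergence in Γ \ G forces v → ∞; this is (c). For (b), an ultrafilter on Γ \ G either contains a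
compact set, and then converges, or diverges, and then its laws tend to δ₀. -/

theorem e_add (x y : ℝ) : e (x + y) = e x * e y := by
  rw [e, e, e, ← Complex.exp_add]
  push_cast
  ring_nf

theorem e_int (n : ℤ) : e n = 1 := by
  rw [e, Complex.exp_eq_one_iff]
  exact ⟨n, by push_cast; ring⟩

theorem e_add_int (x : ℝ) (n : ℤ) : e (x + n) = e x := by
  rw [e_add, e_int, mul_one]

theorem e_zero : e 0 = 1 := by simpa using e_int 0

theorem enorm_e (x : ℝ) : ‖e x‖ₑ = 1 := by
  rw [← ofReal_norm, norm_e, ENNReal.ofReal_one]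

theorem e_int_mul_fract (n : ℤ) (x : ℝ) : e (n * Int.fract x) = e (n * x) := by
  rw [Int.fract, ← e_add_int _ (n * ⌊x⌋)]
  congr 1
  push_cast
  ring

theorem eLpNorm_two_sq {α : Type*} [MeasurableSpace α] (μ : Measure α) (f : α → ℂ) :
    eLpNorm f 2 μ ^ 2 = ∫⁻ x, ‖f x‖ₑ ^ 2 ∂μ := by
  have := eLpNorm_nnreal_pow_eq_lintegral (μ := μ) (f := f) (p := 2) two_ne_zero
  simpa using this

theorem restrict_Ioc_eq_unif : volume.restrict (Set.Ioc (0 : ℝ) 1) = unif :=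
  Measure.restrict_congr_set Ico_ae_eq_Ioc.symm

/-- Parseval's identity on `[0,1)`. -/
theorem parseval_unif {f : ℝ → ℂ} (hf : MemLp f 2 unif) :
    ∫⁻ x, ‖f x‖ₑ ^ 2 ∂unif = ∑' n : ℤ, ‖∫ x, e (-(n * x)) * f x ∂unif‖ₑ ^ 2 := by
  have h := hasSum_sq_fourierCoeffOn (f := f) (zero_lt_one' ℝ) (by rwa [restrict_Ioc_eq_unif])
  have hc : ∀ n : ℤ, fourierCoeffOn (zero_lt_one' ℝ) f n = ∫ x, e (-(n * x)) * f x ∂unif := by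
    intro n
    rw [fourierCoeffOn_eq_integral, intervalIntegral.integral_of_le zero_le_one,
      restrict_Ioc_eq_unif]
    rw [sub_zero, div_one, one_smul]
    refine integral_congr_ae (Eventually.of_forall fun x => ?_)
    simp only [smul_eq_mul]
    rw [fourier_coe_apply, e]
    push_cast
    ring_nf
  simp only [hc] at h
  rw [intervalIntegral.integral_of_le zero_le_one, restrict_Ioc_eq_unif, sub_zero, inv_one,
    one_smul] at h
  have h2 := ENNReal.ofReal_tsum_of_nonneg (fun n => sq_nonneg _) h.summable
  rw [h.tsum_eq, ofReal_integral_eq_lintegral_ofReal hf.integrable_norm_pow'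
    (Eventually.of_forall fun _ => by positivity)] at h2
  simpa [ENNReal.ofReal_pow] using h2

theorem integral_e_unif (k : ℤ) : ∫ x, e (k * x) ∂unif = if k = 0 then 1 else 0 := by
  split_ifs with h
  · simp [h, e_zero]
  · have := fourierCoeff_eq_intervalIntegral (T := 1) (fourier (T := (1 : ℝ)) k) 0 0
    have h2 := fourierCoeff_fourier (T := 1) k
    rw [h2, Pi.single_apply, if_neg (Ne.symm h), intervalIntegral.integral_of_le (by norm_num), zero_add,
      restrict_Ioc_eq_unif] at this
    simp only [neg_zero, fourier_zero, one_smul, div_one] at this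
    rw [this]
    refine integral_congr_ae (Eventually.of_forall fun x => ?_)
    simp only [fourier_coe_apply, e]
    push_cast; ring_nf

/-- The integral over `ℝ` is the integral over `[0,1)` of the sum over the translates. -/
theorem lintegral_eq_tsum_unif {F : ℝ → ENNReal} :
    ∫⁻ w, F w = ∑' n : ℤ, ∫⁻ y, F (n - y) ∂unif := by
  -- Starting the partition at -1 makes the pieces (n - 1, n], which are exactly the images of [0,1)
  -- under y ↦ n - y.
  rw [← setLIntegral_univ, ← iUnion_Ioc_add_intCast (-1 : ℝ), lintegral_iUnion (fun _ => measurableSet_Ioc)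
    (Set.pairwise_disjoint_Ioc_add_intCast (-1 : ℝ))]
  refine tsum_congr fun n => ?_
  have hmp : MeasurePreserving (fun y : ℝ => (n : ℝ) - y) volume volume :=
    Measure.measurePreserving_sub_left volume (n : ℝ)
  have he : MeasurableEmbedding (fun y : ℝ => (n : ℝ) - y) :=
    (MeasurableEquiv.subLeft (n : ℝ)).measurableEmbedding
  rw [← hmp.setLIntegral_comp_preimage_emb he, unif]
  congr 2
  ext y
  simp only [Set.mem_preimage, Set.mem_Ioc, Set.mem_Ico]
  constructor <;> rintro ⟨h1, h2⟩ <;> constructor <;> linarith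

/-! ### The Zak transform -/

/-- The `n`-th term of the Zak transform of `g`. -/
def zakTerm (g : ℝ → ℂ) (n : ℤ) (p : ℝ × ℝ) : ℂ := g (n - p.2) * e (n * p.1)

theorem measurable_zakTerm {g : ℝ → ℂ} (hg : Measurable g) (n : ℤ) : Measurable (zakTerm g n) := by
  unfold zakTerm
  refine (hg.comp (by fun_prop)).mul (continuous_e.measurable.comp (by fun_prop))

theorem memLp_trigPoly (s : Finset ℤ) (c : ℤ → ℂ) :
    MemLp (fun x => ∑ n ∈ s, c n * e (n * x)) 2 unif := by
  refine MemLp.of_bound (C := ∑ n ∈ s, ‖c n‖) ?_ (Eventually.of_forall fun x => ?_)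
  · have : Continuous fun x => ∑ n ∈ s, c n * e (n * x) :=
      continuous_finsetSum _ fun n _ => continuous_const.mul (continuous_e.comp (by fun_prop))
    exact this.aestronglyMeasurable
  · refine (norm_sum_le _ _).trans (Finset.sum_le_sum fun n _ => ?_)
    rw [norm_mul, norm_e, mul_one]

theorem integrable_e_mul {f : ℝ → ℂ} (hf : Integrable f unif) (n : ℤ) :
    Integrable (fun x => e (-(n * x)) * f x) unif :=
  hf.bdd_mul (c := 1) (continuous_e.comp (by fun_prop)).aestronglyMeasurable
    (Eventually.of_forall fun x => (norm_e _).le)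

theorem integral_e_trigPoly (s : Finset ℤ) (c : ℤ → ℂ) (m : ℤ) :
    ∫ x, e (-(m * x)) * ∑ n ∈ s, c n * e (n * x) ∂unif = if m ∈ s then c m else 0 := by
  have h1 : ∀ x : ℝ, e (-(m * x)) * ∑ n ∈ s, c n * e (n * x) =
      ∑ n ∈ s, c n * e (((n - m : ℤ) : ℝ) * x) := by
    intro x
    rw [Finset.mul_sum]
    refine Finset.sum_congr rfl fun n _ => ?_
    rw [show ((n - m : ℤ) : ℝ) * x = -(m * x) + n * x by push_cast; ring, e_add]
    ring
  simp_rw [h1]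
  rw [integral_finsetSum _ fun n _ => ?_]
  · simp_rw [integral_const_mul, integral_e_unif, sub_eq_zero]
    simp
  · refine Integrable.const_mul ?_ _
    refine Integrable.of_bound (C := 1) (continuous_e.comp (by fun_prop)).aestronglyMeasurable
      (Eventually.of_forall fun x => (norm_e _).le)

theorem lintegral_trigPoly (s : Finset ℤ) (c : ℤ → ℂ) :
    ∫⁻ x, ‖∑ n ∈ s, c n * e (n * x)‖ₑ ^ 2 ∂unif = ∑ n ∈ s, ‖c n‖ₑ ^ 2 := by
  rw [parseval_unif (memLp_trigPoly s c)]
  simp_rw [integral_e_trigPoly]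
  rw [tsum_eq_sum (s := s)]
  · exact Finset.sum_congr rfl fun n hn => by rw [if_pos hn]
  · intro n hn
    simp [hn]

/-- For fixed y the sum is a trigonometric polynomial in x, so Parseval removes the cross terms. The
terms of the Zak transform are thus orthogonal. -/
theorem lintegral_sum_zakTerm {g : ℝ → ℂ} (hg : Measurable g) (s : Finset ℤ) :
    ∫⁻ p, ‖∑ n ∈ s, zakTerm g n p‖ₑ ^ 2 ∂(unif.prod unif) =
      ∑ n ∈ s, ∫⁻ y, ‖g (n - y)‖ₑ ^ 2 ∂unif := by
  rw [lintegral_prod_symm _ ?_]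
  · simp only [zakTerm]
    simp_rw [lintegral_trigPoly s]
    rw [lintegral_finsetSum]
    intro n _
    exact (hg.comp (by fun_prop)).enorm.pow_const _
  · exact (Finset.measurable_sum _ fun n _ => measurable_zakTerm hg n).enorm.pow_const _ |>.aemeasurable

theorem lintegral_zakTerm {g : ℝ → ℂ} (hg : Measurable g) (n : ℤ) :
    ∫⁻ p, ‖zakTerm g n p‖ₑ ^ 2 ∂(unif.prod unif) = ∫⁻ y, ‖g (n - y)‖ₑ ^ 2 ∂unif := by
  simpa using lintegral_sum_zakTerm hg {n}

/-- Measurable square integrable functions. -/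
structure SqInt (g : ℝ → ℂ) : Prop where
  meas : Measurable g
  fin : ∫⁻ w, ‖g w‖ₑ ^ 2 ≠ ⊤

theorem SqInt.of_memLp {g : ℝ → ℂ} (h : Measurable g) (hg : MemLp g 2 volume) : SqInt g :=
  ⟨h, by rw [← eLpNorm_two_sq]; exact ENNReal.pow_ne_top hg.2.ne⟩

theorem memLp_two_of_lintegral {α : Type*} [MeasurableSpace α] {μ : Measure α} {f : α → ℂ}
    (hf : AEStronglyMeasurable f μ) (h : ∫⁻ x, ‖f x‖ₑ ^ 2 ∂μ ≠ ⊤) : MemLp f 2 μ := by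
  refine ⟨hf, ?_⟩
  rw [← eLpNorm_two_sq] at h
  rw [lt_top_iff_ne_top]
  intro h'
  simp [h'] at h

theorem SqInt.memLp {g : ℝ → ℂ} (hg : SqInt g) : MemLp g 2 volume :=
  memLp_two_of_lintegral hg.meas.aestronglyMeasurable hg.fin

theorem SqInt.sub {g h : ℝ → ℂ} (hg : SqInt g) (hh : SqInt h) : SqInt (g - h) :=
  .of_memLp (hg.meas.sub hh.meas) (hg.memLp.sub hh.memLp)

theorem SqInt.memLp_zakTerm {g : ℝ → ℂ} (hg : SqInt g) (n : ℤ) :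
    MemLp (zakTerm g n) 2 (unif.prod unif) := by
  refine memLp_two_of_lintegral (measurable_zakTerm hg.meas n).aestronglyMeasurable ?_
  rw [lintegral_zakTerm hg.meas]
  have := hg.fin
  rw [lintegral_eq_tsum_unif] at this
  exact ENNReal.ne_top_of_tsum_ne_top this n

/-- The `n`-th term of the Zak transform as an element of `L²`. -/
def SqInt.zakTermLp {g : ℝ → ℂ} (hg : SqInt g) (n : ℤ) : Lp ℂ 2 (unif.prod unif) :=
  (hg.memLp_zakTerm n).toLp (zakTerm g n)

/-- The Zak transform of `g`. -/
def SqInt.zak {g : ℝ → ℂ} (hg : SqInt g) : Lp ℂ 2 (unif.prod unif) := ∑' n : ℤ, hg.zakTermLp n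

theorem enorm_sq_Lp {α : Type*} [MeasurableSpace α] {μ : Measure α} (f : Lp ℂ 2 μ) :
    ‖f‖ₑ ^ 2 = ∫⁻ x, ‖f x‖ₑ ^ 2 ∂μ := by
  rw [← eLpNorm_two_sq, Lp.enorm_def]

theorem SqInt.coeFn_sum {g : ℝ → ℂ} (hg : SqInt g) (s : Finset ℤ) :
    ∑ n ∈ s, hg.zakTermLp n =
      MemLp.toLp (fun p => ∑ n ∈ s, zakTerm g n p)
        (memLp_finsetSum s fun n _ => hg.memLp_zakTerm n) := by
  induction s using Finset.induction_on with
  | empty => simp only [Finset.sum_empty]; rfl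
  | insert a s ha ih =>
    rw [Finset.sum_insert ha, ih, SqInt.zakTermLp, ← MemLp.toLp_add]
    congr 1
    ext p
    rw [Finset.sum_insert ha, Pi.add_apply]

theorem SqInt.enorm_sum {g : ℝ → ℂ} (hg : SqInt g) (s : Finset ℤ) :
    ‖∑ n ∈ s, hg.zakTermLp n‖ₑ ^ 2 = ∑ n ∈ s, ∫⁻ y, ‖g (n - y)‖ₑ ^ 2 ∂unif := by
  rw [hg.coeFn_sum, Lp.enorm_toLp, eLpNorm_two_sq, lintegral_sum_zakTerm hg.meas]

/-- The terms are orthogonal and their squared norms add up to ‖g‖², so the Cauchy criterion over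
finite sets reduces to the tails of a convergent sum of nonnegative numbers. -/
theorem SqInt.summable_zakTermLp {g : ℝ → ℂ} (hg : SqInt g) : Summable hg.zakTermLp := by
  rw [summable_iff_cauchySeq_finset, cauchySeq_finset_iff_vanishing_norm]
  intro ε hε
  have hf := hg.fin
  rw [lintegral_eq_tsum_unif] at hf
  have h0 := ENNReal.tendsto_tsum_compl_atTop_zero hf
  have h1 := h0.eventually (gt_mem_nhds (show (0 : ENNReal) < ENNReal.ofReal ε ^ 2 by positivity))
  obtain ⟨s, hs⟩ := h1.exists
  refine ⟨s, fun t ht => ?_⟩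
  have h2 : ‖∑ n ∈ t, hg.zakTermLp n‖ₑ ^ 2 < ENNReal.ofReal ε ^ 2 := by
    rw [hg.enorm_sum]
    refine lt_of_le_of_lt ?_ hs
    have hinj : Function.Injective (fun n : t => (⟨n, fun h => (Finset.disjoint_left.mp ht) n.2 h⟩ : {x // x ∉ s})) :=
      fun a b h => Subtype.ext (Subtype.mk.inj h)
    rw [← Finset.tsum_subtype]
    exact ENNReal.tsum_comp_le_tsum_of_injective hinj
      (fun n : {x // x ∉ s} => ∫⁻ y, ‖g ((n : ℤ) - y)‖ₑ ^ 2 ∂unif)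
  have h3 := lt_of_pow_lt_pow_left' 2 h2
  rwa [← ofReal_norm, ENNReal.ofReal_lt_ofReal_iff hε] at h3

theorem SqInt.enorm_zak {g : ℝ → ℂ} (hg : SqInt g) : ‖hg.zak‖ₑ ^ 2 = ∫⁻ w, ‖g w‖ₑ ^ 2 := by
  have h1 : Tendsto (fun s : Finset ℤ => ‖∑ n ∈ s, hg.zakTermLp n‖ₑ ^ 2) atTop
      (𝓝 (‖hg.zak‖ₑ ^ 2)) :=
    ((ENNReal.continuous_pow 2).tendsto _).comp
      ((continuous_enorm.tendsto _).comp hg.summable_zakTermLp.hasSum)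
  simp_rw [hg.enorm_sum] at h1
  refine tendsto_nhds_unique h1 ?_
  rw [lintegral_eq_tsum_unif]
  exact (ENNReal.summable (f := fun n : ℤ => ∫⁻ y, ‖g (n - y)‖ₑ ^ 2 ∂unif)).hasSum

theorem SqInt.zak_sub {g h : ℝ → ℂ} (hg : SqInt g) (hh : SqInt h) :
    (hg.sub hh).zak = hg.zak - hh.zak := by
  rw [SqInt.zak, SqInt.zak, SqInt.zak, ← hg.summable_zakTermLp.tsum_sub hh.summable_zakTermLp]
  refine tsum_congr fun n => ?_
  rw [SqInt.zakTermLp, SqInt.zakTermLp, SqInt.zakTermLp, ← MemLp.toLp_sub]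
  congr 1
  ext p
  simp [zakTerm, sub_mul]

theorem SqInt.tendsto_zak {ι : Type*} {l : Filter ι} {G : ι → ℝ → ℂ} {g : ℝ → ℂ}
    (hG : ∀ i, SqInt (G i)) (hg : SqInt g)
    (h : Tendsto (fun i => ∫⁻ w, ‖G i w - g w‖ₑ ^ 2) l (𝓝 0)) :
    Tendsto (fun i => (hG i).zak) l (𝓝 hg.zak) := by
  rw [tendsto_iff_edist_tendsto_0]
  have : ∀ i, edist (hG i).zak hg.zak = (∫⁻ w, ‖G i w - g w‖ₑ ^ 2) ^ (1 / 2 : ℝ) := by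
    intro i
    have h2 := ((hG i).sub hg).enorm_zak
    rw [SqInt.zak_sub (hG i) hg, ← edist_eq_enorm_sub] at h2
    simp only [Pi.sub_apply] at h2
    rw [← h2, ← ENNReal.rpow_natCast, ← ENNReal.rpow_mul]
    norm_num
  simp_rw [this]
  have := h.ennrpow_const (1 / 2 : ℝ)
  simpa using this

/-- The partial sums of the Zak transform converge to it. -/
theorem SqInt.tendsto_eLpNorm {g : ℝ → ℂ} (hg : SqInt g) :
    Tendsto (fun s : Finset ℤ => eLpNorm ((fun p => ∑ n ∈ s, zakTerm g n p) - ⇑hg.zak) 2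
      (unif.prod unif)) atTop (𝓝 0) := by
  have h := (Lp.tendsto_Lp_iff_tendsto_eLpNorm' _ _).mp hg.summable_zakTermLp.hasSum
  refine h.congr fun s => eLpNorm_congr_ae ?_
  have hs : ⇑(∑ n ∈ s, hg.zakTermLp n) =ᵐ[unif.prod unif] fun p => ∑ n ∈ s, zakTerm g n p := by
    rw [hg.coeFn_sum]
    exact MemLp.coeFn_toLp _
  filter_upwards [hs] with p hp
  rw [Pi.sub_apply, Pi.sub_apply, hp]
  rfl

/-- An `L²` limit of the partial sums is the Zak transform. -/
theorem SqInt.zak_ae_eq_of_tendsto {g : ℝ → ℂ} (hg : SqInt g) {F : ℝ × ℝ → ℂ}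
    (hF : AEStronglyMeasurable F (unif.prod unif))
    (h : Tendsto (fun s : Finset ℤ => ∫⁻ p, ‖F p - ∑ n ∈ s, zakTerm g n p‖ₑ ^ 2 ∂(unif.prod unif))
      atTop (𝓝 0)) : hg.zak =ᵐ[unif.prod unif] F := by
  have hm : ∀ s : Finset ℤ, AEStronglyMeasurable (fun p => ∑ n ∈ s, zakTerm g n p) (unif.prod unif) :=
    fun s => (Finset.measurable_sum _ fun n _ => measurable_zakTerm hg.meas n).aestronglyMeasurable
  have h1 := tendstoInMeasure_of_tendsto_eLpNorm two_ne_zero hm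
    (Lp.aestronglyMeasurable _) hg.tendsto_eLpNorm
  have h2 := tendstoInMeasure_of_tendsto_eLpNorm (p := 2) two_ne_zero hm hF (l := atTop) (by
    have h' := h.ennrpow_const (1 / 2 : ℝ)
    rw [ENNReal.zero_rpow_of_pos (by norm_num)] at h'
    refine h'.congr fun s => ?_
    have := eLpNorm_two_sq (unif.prod unif) ((fun p => ∑ n ∈ s, zakTerm g n p) - F)
    have h3 : ∀ p, ‖F p - ∑ n ∈ s, zakTerm g n p‖ₑ = ‖((fun p => ∑ n ∈ s, zakTerm g n p) - F) p‖ₑ := by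
      intro p
      rw [Pi.sub_apply, ← edist_eq_enorm_sub, ← edist_eq_enorm_sub, edist_comm]
    simp_rw [h3]
    rw [← this, ← ENNReal.rpow_natCast, ← ENNReal.rpow_mul]
    norm_num)
  exact tendstoInMeasure_ae_unique h1 h2

/-- A pointwise sum of the Zak transform is equal to it. -/
theorem SqInt.zak_ae_eq_of_hasSum {g : ℝ → ℂ} (hg : SqInt g) {F : ℝ × ℝ → ℂ} {A : Set (ℝ × ℝ)}
    (h : ∀ᵐ p ∂(unif.prod unif), p ∈ A → HasSum (fun n => zakTerm g n p) (F p)) :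
    ∀ᵐ p ∂(unif.prod unif), p ∈ A → hg.zak p = F p := by
  have hm : ∀ s : Finset ℤ, AEStronglyMeasurable (fun p => ∑ n ∈ s, zakTerm g n p) (unif.prod unif) :=
    fun s => (Finset.measurable_sum _ fun n _ => measurable_zakTerm hg.meas n).aestronglyMeasurable
  have h1 := tendstoInMeasure_of_tendsto_eLpNorm two_ne_zero hm
    (Lp.aestronglyMeasurable _) hg.tendsto_eLpNorm
  -- L² convergence yields almost everywhere convergence only along some sequence of finite sets;
  -- where the full sum exists, it determines the limit.
  obtain ⟨ns, hns, hae⟩ := h1.exists_seq_tendsto_ae'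
  filter_upwards [hae, h] with p hp1 hp2 hA
  exact tendsto_nhds_unique hp1 ((hp2 hA).comp hns)

/-! ### The law of `e(t) |F|` -/

/-- The random variable `e(t) |F(ξ)|`. -/
def lawVar (F : Lp ℂ 2 (unif.prod unif)) (z : ℝ × ℝ × ℝ) : ℂ := e z.1 * ((‖F z.2‖ : ℝ) : ℂ)

theorem measurable_lawVar (F : Lp ℂ 2 (unif.prod unif)) : Measurable (lawVar F) := by
  unfold lawVar
  refine Measurable.mul (continuous_e.measurable.comp measurable_fst) ?_
  exact Complex.measurable_ofReal.comp
    (((Lp.stronglyMeasurable F).measurable.comp measurable_snd).norm)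

/-- The law of `e(t) |F(ξ)|`. -/
def law (F : Lp ℂ 2 (unif.prod unif)) : ProbabilityMeasure ℂ :=
  ⟨(unif.prod (unif.prod unif)).map (lawVar F),
    Measure.isProbabilityMeasure_map (measurable_lawVar F).aemeasurable⟩

theorem edist_lawVar_le (F G : Lp ℂ 2 (unif.prod unif)) (z : ℝ × ℝ × ℝ) :
    edist (lawVar F z) (lawVar G z) ≤ edist (F z.2) (G z.2) := by
  rw [edist_dist, edist_dist]
  refine ENNReal.ofReal_le_ofReal ?_
  rw [lawVar, lawVar, dist_eq_norm, ← mul_sub, norm_mul, norm_e, one_mul, ← Complex.ofReal_sub,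
    Complex.norm_real, dist_eq_norm]
  exact abs_norm_sub_norm_le _ _

/-- Passing from F to e(t)|F| is pointwise 1-Lipschitz, so convergence in measure survives and
implies convergence in distribution. The cusp needs this form, weaker than L² convergence. -/
theorem tendsto_law_of_tendstoInMeasure {ι : Type*} {l : Filter ι} [l.IsCountablyGenerated]
    [l.NeBot] {F : ι → Lp ℂ 2 (unif.prod unif)} {G : Lp ℂ 2 (unif.prod unif)}
    (h : TendstoInMeasure (unif.prod unif) (fun i => ⇑(F i)) l G) :
    Tendsto (fun i => law (F i)) l (𝓝 (law G)) := by
  have h2 : TendstoInMeasure (unif.prod (unif.prod unif)) (fun i => lawVar (F i)) l (lawVar G) := by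
    intro ε hε
    refine tendsto_of_tendsto_of_tendsto_of_le_of_le tendsto_const_nhds (h ε hε)
      (fun _ => zero_le) fun i => ?_
    have hm : MeasurableSet {x | ε ≤ edist (F i x) (G x)} :=
      measurableSet_le measurable_const
        ((Lp.stronglyMeasurable (F i)).measurable.edist (Lp.stronglyMeasurable G).measurable)
    calc (unif.prod (unif.prod unif)) {z | ε ≤ edist (lawVar (F i) z) (lawVar G z)}
        ≤ (unif.prod (unif.prod unif)) (Prod.snd ⁻¹' {x | ε ≤ edist (F i x) (G x)}) :=
          measure_mono fun z hz => le_trans (Set.mem_ofPred.mp hz) (edist_lawVar_le _ _ z)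
      _ = _ := (measurePreserving_snd (μ := unif) (ν := unif.prod unif)).measure_preimage
          hm.nullMeasurableSet
  exact (h2.tendstoInDistribution fun i => (measurable_lawVar _).aemeasurable).tendsto

theorem tendsto_law {ι : Type*} {l : Filter ι} [l.IsCountablyGenerated]
    [l.NeBot] {F : ι → Lp ℂ 2 (unif.prod unif)} {G : Lp ℂ 2 (unif.prod unif)}
    (h : Tendsto F l (𝓝 G)) : Tendsto (fun i => law (F i)) l (𝓝 (law G)) :=
  tendsto_law_of_tendstoInMeasure (tendstoInMeasure_of_tendsto_Lp h)

/-- All invariance statements rest on this: unimodular factors, even depending on the point, and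
measure preserving substitutions are invisible to the law. -/
theorem law_eq_of_norm_eq {F G : Lp ℂ 2 (unif.prod unif)} {φ : ℝ × ℝ → ℝ × ℝ}
    (hφ : MeasurePreserving φ (unif.prod unif) (unif.prod unif))
    (h : ∀ᵐ p ∂(unif.prod unif), ‖G p‖ = ‖F (φ p)‖) : law G = law F := by
  refine Subtype.ext ?_
  change (unif.prod (unif.prod unif)).map (lawVar G) = (unif.prod (unif.prod unif)).map (lawVar F)
  have hmp := (MeasurePreserving.id unif).prod hφ
  conv_rhs => rw [← hmp.map_eq, Measure.map_map (measurable_lawVar F) hmp.measurable]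
  refine Measure.map_congr ?_
  have h' := (Measure.quasiMeasurePreserving_snd (μ := unif) (ν := unif.prod unif)).ae h
  filter_upwards [h'] with z hz
  simp only [lawVar, Function.comp, Prod.map, id, hz]

theorem law_zero : law 0 = delta0 := by
  refine Subtype.ext ?_
  change (unif.prod (unif.prod unif)).map (lawVar 0) = Measure.dirac 0
  have h' := (Measure.quasiMeasurePreserving_snd (μ := unif) (ν := unif.prod unif)).ae
    (Lp.coeFn_zero ℂ 2 (unif.prod unif))
  have : lawVar 0 =ᵐ[unif.prod (unif.prod unif)] fun _ => 0 := by
    filter_upwards [h'] with z hz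
    rw [lawVar, hz]
    simp
  rw [Measure.map_congr this, Measure.map_const]
  simp

/-! ### Measure preserving maps of the torus -/

theorem lintegral_fract_Ioc (F : ℝ → ENNReal) (c : ℝ) :
    ∫⁻ x in Set.Ioc c (c + 1), F (Int.fract x) = ∫⁻ x, F x ∂unif := by
  have hper : Function.Periodic (fun x => F (Int.fract x)) 1 := fun x => by
    simp only [Int.fract_add_one]
  have h1 := AddCircle.lintegral_preimage 1 c hper.lift
  have h2 := AddCircle.lintegral_preimage 1 0 hper.lift
  simp only [Function.Periodic.lift_coe] at h1 h2
  rw [h1, ← h2, zero_add, restrict_Ioc_eq_unif, unif]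
  refine setLIntegral_congr_fun measurableSet_Ico fun x hx => ?_
  rw [Int.fract_eq_self.mpr hx]

theorem measurePreserving_fract_add (c : ℝ) :
    MeasurePreserving (fun x => Int.fract (x + c)) unif unif := by
  have hm : Measurable fun x : ℝ => Int.fract (x + c) := by fun_prop
  refine ⟨hm, Measure.ext_of_lintegral _ fun F hF => ?_⟩
  rw [lintegral_map hF hm, ← lintegral_fract_Ioc F c]
  have h := (measurePreserving_add_right volume c).setLIntegral_comp_preimage_emb
    (measurableEmbedding_addRight c) (fun x => F (Int.fract x)) (Set.Ioc c (c + 1))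
  rw [← h, ← restrict_Ioc_eq_unif]
  congr 2
  ext x
  simp only [Set.mem_preimage, Set.mem_Ioc]
  constructor <;> rintro ⟨h1, h2⟩ <;> constructor <;> linarith

theorem measurePreserving_fract_neg : MeasurePreserving (fun x => Int.fract (-x)) unif unif := by
  have hm : Measurable fun x : ℝ => Int.fract (-x) := by fun_prop
  refine ⟨hm, Measure.ext_of_lintegral _ fun F hF => ?_⟩
  rw [lintegral_map hF hm, ← lintegral_fract_Ioc F (-1)]
  have h := (Measure.measurePreserving_neg (volume : Measure ℝ)).setLIntegral_comp_preimage_emb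
    (MeasurableEquiv.neg ℝ).measurableEmbedding (fun x => F (Int.fract x)) (Set.Ioc (-1) (-1 + 1))
  rw [← h, unif]
  congr 2
  ext x
  simp only [Set.mem_preimage, Set.mem_Ioc, Set.mem_Ico]
  constructor <;> rintro ⟨h1, h2⟩ <;> constructor <;> linarith

/-- The action of `((1,1),(0,1))` on the torus. -/
def shear (p : ℝ × ℝ) : ℝ × ℝ := (Int.fract (p.1 + (1 / 2 - p.2)), p.2)

/-- The action of `((0,-1),(1,0))` on the torus. -/
def quarterTurn (p : ℝ × ℝ) : ℝ × ℝ := (p.2, Int.fract (-p.1))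

/-- On each line of constant y the map is a rotation of the circle, so this is a skew product. -/
theorem measurePreserving_shear :
    MeasurePreserving shear (unif.prod unif) (unif.prod unif) := by
  have h := (MeasurePreserving.id unif).skew_product (μc := unif) (μd := unif)
    (g := fun y x => Int.fract (x + (1 / 2 - y))) (by unfold Function.uncurry; fun_prop)
    (Eventually.of_forall fun y => (measurePreserving_fract_add _).map_eq)
  exact (Measure.measurePreserving_swap.comp h).comp Measure.measurePreserving_swap

theorem measurePreserving_quarterTurn :
    MeasurePreserving quarterTurn (unif.prod unif) (unif.prod unif) :=
  ((MeasurePreserving.id unif).prod measurePreserving_fract_neg).comp Measure.measurePreserving_swap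

theorem lintegral_comp_mp {φ : ℝ × ℝ → ℝ × ℝ} (hφ : MeasurePreserving φ (unif.prod unif) (unif.prod unif))
    {F : ℝ × ℝ → ENNReal} (hF : AEMeasurable F (unif.prod unif)) :
    ∫⁻ p, F (φ p) ∂(unif.prod unif) = ∫⁻ p, F p ∂(unif.prod unif) := by
  rw [← lintegral_map' (f := F) (by rwa [hφ.map_eq]) hφ.aemeasurable, hφ.map_eq]

/-- Multiplication by the chirp `e(w²/2)` does not change the law of the Zak transform. -/
theorem law_zak_chirp {g h : ℝ → ℂ} (hg : SqInt g) (hh : SqInt h)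
    (hgh : ∀ w, h w = e ((1 / 2) * w ^ 2) * g w) : law hh.zak = law hg.zak := by
  have hterm : ∀ n p, zakTerm h n p = e ((1 / 2) * p.2 ^ 2) * zakTerm g n (shear p) := by
    intro n p
    simp only [zakTerm, shear, hgh, e_int_mul_fract]
    have : e ((1 / 2) * (n - p.2) ^ 2) * e (n * p.1) =
        e ((1 / 2) * p.2 ^ 2) * e (n * (p.1 + (1 / 2 - p.2))) := by
      rw [← e_add, ← e_add]
      -- Since n² and n have the same parity, e(n²/2) = e(n/2). This is the source of the shift by
      -- 1/2 in `shear`.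
      obtain ⟨k, hk⟩ : ∃ k : ℤ, (n : ℝ) ^ 2 - n = 2 * k := by
        obtain ⟨k, hk⟩ := Int.even_mul_pred_self n
        exact ⟨k, by have : (n : ℝ) * (n - 1) = k + k := by exact_mod_cast hk
                     linarith⟩
      rw [← e_add_int ((1 / 2) * p.2 ^ 2 + n * (p.1 + (1 / 2 - p.2))) k]
      congr 1
      linear_combination hk / 2
    linear_combination g (n - p.2) * this
  have hmm : Measurable fun p : ℝ × ℝ => e ((1 / 2) * p.2 ^ 2) :=
    continuous_e.measurable.comp (by fun_prop)
  have hae : hh.zak =ᵐ[unif.prod unif] fun p => e ((1 / 2) * p.2 ^ 2) * hg.zak (shear p) := by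
    refine hh.zak_ae_eq_of_tendsto ?_ ?_
    · exact (hmm.mul ((Lp.stronglyMeasurable hg.zak).measurable.comp
        measurePreserving_shear.measurable)).aestronglyMeasurable
    · have h2 := (ENNReal.continuous_pow 2).tendsto _ |>.comp hg.tendsto_eLpNorm
      simp only [ne_eq, OfNat.ofNat_ne_zero, not_false_eq_true, zero_pow] at h2
      refine h2.congr fun s => ?_
      simp only [Function.comp]
      rw [eLpNorm_two_sq, ← lintegral_comp_mp measurePreserving_shear]
      · refine lintegral_congr fun p => ?_
        simp only [hterm, ← Finset.mul_sum, ← mul_sub, enorm_mul, enorm_e, one_mul, Pi.sub_apply]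
        rw [← edist_eq_enorm_sub, ← edist_eq_enorm_sub, edist_comm]
      · exact (((Finset.measurable_sum _ fun n _ => measurable_zakTerm hg.meas n).sub
          (Lp.stronglyMeasurable hg.zak).measurable).enorm.pow_const _).aemeasurable
  refine law_eq_of_norm_eq measurePreserving_shear ?_
  filter_upwards [hae] with p hp
  rw [hp, norm_mul, norm_e, one_mul]

/-- Multiplication by a phase does not change the law of the Zak transform. -/
theorem law_zak_phase {g h : ℝ → ℂ} (hg : SqInt g) (hh : SqInt h) {c : ℂ} (hc : ‖c‖ = 1)
    (hgh : ∀ w, h w = c * g w) : law hh.zak = law hg.zak := by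
  have : hh.zak = c • hg.zak := by
    rw [SqInt.zak, SqInt.zak, ← hg.summable_zakTermLp.tsum_const_smul]
    refine tsum_congr fun n => ?_
    rw [SqInt.zakTermLp, SqInt.zakTermLp, ← MemLp.toLp_const_smul]
    congr 1
    ext p
    simp [zakTerm, hgh, mul_assoc]
  refine law_eq_of_norm_eq (MeasurePreserving.id _) ?_
  rw [this]
  filter_upwards [Lp.coeFn_smul c hg.zak] with p hp
  rw [hp, Pi.smul_apply, norm_smul, hc, one_mul, id]

/-! ### Poisson summation -/

/-- The Fourier transform. -/
def ft (h : ℝ → ℂ) (η : ℝ) : ℂ := ∫ t, h t * e (-(t * η))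

theorem measurable_ft {h : ℝ → ℂ} (hm : Measurable h) : Measurable (ft h) := by
  refine StronglyMeasurable.measurable (StronglyMeasurable.integral_prod_right'
    (f := fun z : ℝ × ℝ => h z.2 * e (-(z.2 * z.1))) ?_)
  refine Measurable.stronglyMeasurable ?_
  exact (hm.comp measurable_snd).mul (continuous_e.measurable.comp (by fun_prop))

theorem lintegral_ofReal_decay_ne_top (C : ℝ) :
    ∫⁻ w : ℝ, ENNReal.ofReal (C * (1 + w ^ 2)⁻¹) ≠ ⊤ :=
  (integrable_inv_one_add_sq.const_mul C).lintegral_lt_top.ne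

theorem enorm_sq_le_ofReal {z : ℂ} {r : ℝ} (h : ‖z‖ ^ 2 ≤ r) : ‖z‖ₑ ^ 2 ≤ ENNReal.ofReal r := by
  rw [← ofReal_norm, ← ENNReal.ofReal_pow (norm_nonneg _)]
  exact ENNReal.ofReal_le_ofReal h

theorem SqInt.of_bound {g : ℝ → ℂ} (hm : Measurable g) {C : ℝ}
    (hb : ∀ w, ‖g w‖ ^ 2 ≤ C * (1 + w ^ 2)⁻¹) : SqInt g :=
  ⟨hm, ne_top_of_le_ne_top (lintegral_ofReal_decay_ne_top C)
    (lintegral_mono fun w => enorm_sq_le_ofReal (hb w))⟩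

/-- Measurable functions with `h(w) = O(1/(1+w²))`. -/
structure Decay (h : ℝ → ℂ) (C : ℝ) : Prop where
  meas : Measurable h
  bound : ∀ w, ‖h w‖ ≤ C * (1 + w ^ 2)⁻¹

section Poisson

variable {h : ℝ → ℂ} {C : ℝ}

theorem Decay.nonneg (hh : Decay h C) : 0 ≤ C := by
  simpa using (norm_nonneg _).trans (hh.bound 0)

theorem Decay.sqInt (hh : Decay h C) : SqInt h := by
  refine SqInt.of_bound (C := C ^ 2) hh.meas fun w => ?_
  refine (pow_le_pow_left₀ (norm_nonneg _) (hh.bound w) 2).trans ?_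
  rw [mul_pow]
  refine mul_le_mul_of_nonneg_left ?_ (sq_nonneg _)
  refine pow_le_of_le_one (by positivity) (inv_le_one_of_one_le₀ (by nlinarith [sq_nonneg w])) two_ne_zero

theorem Decay.integrable (hh : Decay h C) : Integrable h :=
  (integrable_inv_one_add_sq.const_mul C).mono' hh.meas.aestronglyMeasurable
    (Eventually.of_forall hh.bound)

theorem summable_inv_one_add_int_sq : Summable fun m : ℤ => (1 + (m : ℝ) ^ 2)⁻¹ := by
  have h := Real.summable_one_div_int_pow.mpr one_lt_two
  refine h.of_norm_bounded_eventually ?_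
  filter_upwards [(Set.finite_singleton (0 : ℤ)).compl_mem_cofinite] with m hm
  have hm0 : (m : ℝ) ≠ 0 := by exact_mod_cast hm
  rw [Real.norm_of_nonneg (by positivity), one_div]
  exact inv_anti₀ (by positivity) (by linarith)

theorem Decay.bound_translate (hh : Decay h C) (x : ℝ) (m : ℤ) :
    ‖h (x + m)‖ ≤ C * (2 + 2 * x ^ 2) * (1 + (m : ℝ) ^ 2)⁻¹ := by
  refine (hh.bound _).trans ?_
  rw [mul_assoc]
  refine mul_le_mul_of_nonneg_left ?_ hh.nonneg
  rw [← div_eq_mul_inv, le_div_iff₀ (by positivity), inv_mul_le_iff₀ (by positivity)]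
  nlinarith [sq_nonneg (m + 2 * x), sq_nonneg (x * (x + m)), sq_nonneg (x + m)]

/-- The sum over the translates of `h`, twisted by a character. -/
def periodize (h : ℝ → ℂ) (p : ℝ × ℝ) : ℂ := ∑' m : ℤ, h (p.1 + m) * e ((p.1 + m) * p.2)

theorem Decay.hasSum_periodize (hh : Decay h C) (p : ℝ × ℝ) :
    HasSum (fun m : ℤ => h (p.1 + m) * e ((p.1 + m) * p.2)) (periodize h p) := by
  refine Summable.hasSum ?_
  refine (summable_inv_one_add_int_sq.mul_left (C * (2 + 2 * p.1 ^ 2))).of_norm_bounded fun m => ?_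
  rw [norm_mul, norm_e, mul_one]
  exact hh.bound_translate _ _

theorem Decay.measurable_periodize (hh : Decay h C) : Measurable (periodize h) := by
  refine measurable_of_tendsto_metrizable' (atTop : Filter (Finset ℤ))
    (f := fun (s : Finset ℤ) (p : ℝ × ℝ) => ∑ m ∈ s, h (p.1 + (m : ℝ)) * e ((p.1 + m) * p.2)) (fun s => ?_)
    (tendsto_pi_nhds.mpr fun p => hh.hasSum_periodize p)
  refine Finset.measurable_sum _ fun m _ => (hh.meas.comp (by fun_prop)).mul
    (continuous_e.measurable.comp (by fun_prop))

theorem Decay.norm_periodize_le (hh : Decay h C) {p : ℝ × ℝ} (hp : p.1 ∈ Set.Ico (0 : ℝ) 1) :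
    ‖periodize h p‖ ≤ C * 4 * ∑' m : ℤ, (1 + (m : ℝ) ^ 2)⁻¹ := by
  rw [← tsum_mul_left]
  refine tsum_of_norm_bounded (summable_inv_one_add_int_sq.mul_left (C * 4)).hasSum fun m => ?_
  rw [norm_mul, norm_e, mul_one]
  refine (hh.bound_translate _ _).trans ?_
  have : 2 + 2 * p.1 ^ 2 ≤ 4 := by nlinarith [hp.1, hp.2]
  have := hh.nonneg
  gcongr

theorem Decay.memLp_periodize (hh : Decay h C) (y : ℝ) :
    MemLp (fun x => periodize h (x, y)) 2 unif := by
  refine MemLp.of_bound (hh.measurable_periodize.comp (by fun_prop)).aestronglyMeasurable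
    (C * 4 * ∑' m : ℤ, (1 + (m : ℝ) ^ 2)⁻¹) ?_
  filter_upwards [ae_restrict_mem measurableSet_Ico] with x hx
  exact hh.norm_periodize_le hx

/-- Poisson summation in coefficient form: unfolding the sum over m turns the integral over [0,1)
into one over ℝ. The character of m drops out because e(nm) = 1. -/
theorem Decay.integral_periodize (hh : Decay h C) (y : ℝ) (n : ℤ) :
    ∫ x, e (-(n * x)) * periodize h (x, y) ∂unif = ft h (n - y) := by
  set H : ℝ → ℂ := fun t => h t * e (-(t * (n - y))) with hH
  have hHi : Integrable H := by
    refine hh.integrable.mul_bdd (c := 1) (continuous_e.comp (by fun_prop)).aestronglyMeasurable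
      (Eventually.of_forall fun x => (norm_e _).le)
  have key : ∀ x, e (-(n * x)) * periodize h (x, y) = ∑' m : ℤ, H (x + m) := by
    intro x
    rw [periodize, ← tsum_mul_left]
    refine tsum_congr fun m => ?_
    have : e (-(n * x)) * e ((x + m) * y) = e (-((x + m) * (n - y))) := by
      rw [← e_add, ← e_add_int (-((x + m) * (n - y))) (n * m)]
      congr 1
      push_cast
      ring
    simp only [hH]
    linear_combination h (x + m) * this
  simp_rw [key]
  have hu : ∀ f : ℝ → ℂ, ∫ x in (0 : ℝ)..1, f x = ∫ x, f x ∂unif := fun f => by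
    rw [intervalIntegral.integral_of_le zero_le_one, restrict_Ioc_eq_unif]
  have hu' : ∀ f : ℝ → ℝ, ∫ x in (0 : ℝ)..1, f x = ∫ x, f x ∂unif := fun f => by
    rw [intervalIntegral.integral_of_le zero_le_one, restrict_Ioc_eq_unif]
  have h1 := hHi.hasSum_intervalIntegral_comp_add_int
  have h2 := hHi.norm.hasSum_intervalIntegral_comp_add_int
  simp_rw [hu] at h1
  simp_rw [hu'] at h2
  have h3 := hasSum_integral_of_summable_integral_norm (μ := unif) (F := fun (m : ℤ) x => H (x + m))
    (fun m => (hHi.comp_add_right (m : ℝ)).restrict) h2.summable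
  exact h3.unique h1

/-- By the previous computation the partial sum removes exactly the Fourier coefficients with index
in s, so Parseval in x leaves the others. The empty s gives the norm of `periodize h`, and growing s
gives convergence. -/
theorem Decay.lintegral_periodize_sub (hh : Decay h C) (s : Finset ℤ) :
    ∫⁻ p, ‖periodize h p - ∑ n ∈ s, zakTerm (ft h) n p‖ₑ ^ 2 ∂(unif.prod unif) =
      ∑' n : {n : ℤ // n ∉ s}, ∫⁻ y, ‖ft h ((n : ℤ) - y)‖ₑ ^ 2 ∂unif := by
  have hmf := measurable_ft hh.meas
  rw [lintegral_prod_symm _ ?_]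
  swap
  · exact ((hh.measurable_periodize.sub (Finset.measurable_sum _ fun n _ =>
      measurable_zakTerm hmf n)).enorm.pow_const _).aemeasurable
  have h1 : ∀ y, ∫⁻ x, ‖periodize h (x, y) - ∑ n ∈ s, zakTerm (ft h) n (x, y)‖ₑ ^ 2 ∂unif =
      ∑' n : {n : ℤ // n ∉ s}, ‖ft h ((n : ℤ) - y)‖ₑ ^ 2 := by
    intro y
    have hp := memLp_trigPoly s (fun n => ft h (n - y))
    have hq := hh.memLp_periodize y
    rw [parseval_unif (f := fun x => periodize h (x, y) - ∑ n ∈ s, zakTerm (ft h) n (x, y))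
      (hq.sub hp)]
    have h2 : ∀ m : ℤ, ∫ x, e (-(m * x)) * (periodize h (x, y) -
        ∑ n ∈ s, zakTerm (ft h) n (x, y)) ∂unif = if m ∈ s then 0 else ft h (m - y) := by
      intro m
      simp_rw [mul_sub]
      rw [integral_sub, hh.integral_periodize]
      · simp only [zakTerm]
        rw [integral_e_trigPoly s (fun n => ft h (n - y)) m]
        split_ifs <;> simp
      · exact integrable_e_mul (hq.integrable one_le_two) m
      · exact integrable_e_mul (hp.integrable one_le_two) m
    simp_rw [h2]
    have h3 := tsum_subtype {n : ℤ | n ∉ s} (fun n : ℤ => ‖ft h (n - y)‖ₑ ^ 2)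
    refine Eq.trans (tsum_congr fun n => ?_) h3.symm
    by_cases hn : n ∈ s <;> simp [Set.indicator, hn]
  simp_rw [h1]
  rw [lintegral_tsum]
  intro n
  exact ((hmf.comp (by fun_prop)).enorm.pow_const _).aemeasurable

theorem Decay.lintegral_periodize (hh : Decay h C) :
    ∫⁻ p, ‖periodize h p‖ₑ ^ 2 ∂(unif.prod unif) = ∫⁻ η, ‖ft h η‖ₑ ^ 2 := by
  have h0 := hh.lintegral_periodize_sub ∅
  simp only [Finset.sum_empty, sub_zero] at h0
  rw [h0, lintegral_eq_tsum_unif]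
  exact Equiv.tsum_eq (Equiv.subtypeUnivEquiv fun n => Finset.notMem_empty n)
    (fun n : ℤ => ∫⁻ y, ‖ft h (n - y)‖ₑ ^ 2 ∂unif)

theorem Decay.sqInt_ft (hh : Decay h C) : SqInt (ft h) := by
  refine ⟨measurable_ft hh.meas, ?_⟩
  rw [← hh.lintegral_periodize, ← eLpNorm_two_sq]
  refine ENNReal.pow_ne_top (MemLp.of_bound hh.measurable_periodize.aestronglyMeasurable
    (C * 4 * ∑' m : ℤ, (1 + (m : ℝ) ^ 2)⁻¹) ?_).2.ne
  have := (Measure.quasiMeasurePreserving_fst (μ := unif) (ν := unif)).ae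
    (ae_restrict_mem measurableSet_Ico)
  filter_upwards [this] with p hp
  exact hh.norm_periodize_le hp

theorem Decay.zak_ft (hh : Decay h C) : hh.sqInt_ft.zak =ᵐ[unif.prod unif] periodize h := by
  refine hh.sqInt_ft.zak_ae_eq_of_tendsto hh.measurable_periodize.aestronglyMeasurable ?_
  simp_rw [hh.lintegral_periodize_sub]
  have hf := hh.sqInt_ft.fin
  rw [lintegral_eq_tsum_unif] at hf
  exact ENNReal.tendsto_tsum_compl_atTop_zero hf

/-- Factoring out e(xy) turns Σ h(n - y) e(nx) into a sum over translates started at -y. The quarter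
turn replaces -y by x up to an integer, which only reindexes the sum. -/
theorem Decay.zak_quarterTurn (hh : Decay h C) :
    ∀ᵐ p ∂(unif.prod unif), ‖hh.sqInt.zak (quarterTurn p)‖ = ‖periodize h p‖ := by
  have h1 : ∀ p : ℝ × ℝ, HasSum (fun n => zakTerm h n p) (e (p.2 * p.1) * periodize h (-p.2, p.1)) := by
    intro p
    refine ((hh.hasSum_periodize (-p.2, p.1)).mul_left _).congr_fun fun n => ?_
    rw [zakTerm, mul_left_comm, ← e_add]
    ring_nf
  have h2 := hh.sqInt.zak_ae_eq_of_hasSum (A := Set.univ) (Eventually.of_forall fun p _ => h1 p)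
  filter_upwards [measurePreserving_quarterTurn.quasiMeasurePreserving.ae h2] with p hp
  rw [hp trivial, norm_mul, norm_e, one_mul, quarterTurn]
  simp only [Int.fract, neg_sub, sub_neg_eq_add]
  rw [periodize, ← (Equiv.addRight (-⌊-p.1⌋)).tsum_eq]
  simp only [Equiv.coe_addRight]
  rw [periodize]
  congr 1
  refine tsum_congr fun m => ?_
  push_cast
  ring_nf

theorem Decay.law_zak_ft (hh : Decay h C) : law hh.sqInt_ft.zak = law hh.sqInt.zak := by
  refine law_eq_of_norm_eq measurePreserving_quarterTurn ?_
  filter_upwards [hh.zak_ft, hh.zak_quarterTurn] with p h1 h2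
  rw [h1, h2]

/-- Plancherel's formula. -/
theorem Decay.lintegral_ft (hh : Decay h C) : ∫⁻ η, ‖ft h η‖ₑ ^ 2 = ∫⁻ w, ‖h w‖ₑ ^ 2 := by
  rw [← hh.lintegral_periodize, ← hh.sqInt.enorm_zak, enorm_sq_Lp,
    ← lintegral_comp_mp measurePreserving_quarterTurn
      ((Lp.stronglyMeasurable hh.sqInt.zak).measurable.enorm.pow_const _).aemeasurable]
  refine lintegral_congr_ae ?_
  filter_upwards [hh.zak_quarterTurn] with p hp
  rw [← ofReal_norm, ← ofReal_norm, hp]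

end Poisson

/-! ### Oscillatory integrals -/

/-- The integral of `e` of a quadratic polynomial over `[0,1]`. -/
def osc (α β γ : ℝ) : ℂ := ∫ t in (0 : ℝ)..1, e ((1 / 2) * α * t ^ 2 - β * t + γ)

theorem norm_osc_le_one (α β γ : ℝ) : ‖osc α β γ‖ ≤ 1 := by
  have := intervalIntegral.norm_integral_le_of_norm_le_const (a := (0 : ℝ)) (b := 1) (C := 1)
    (f := fun t => e ((1 / 2) * α * t ^ 2 - β * t + γ)) fun t _ => (norm_e _).le
  rwa [sub_zero, abs_one, mul_one] at this

theorem continuous_osc : Continuous fun p : ℝ × ℝ × ℝ => osc p.1 p.2.1 p.2.2 := by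
  refine intervalIntegral.continuous_parametric_intervalIntegral_of_continuous' ?_ 0 1
  unfold Function.uncurry
  exact continuous_e.comp (by fun_prop)

theorem hasDerivAt_e {θ : ℝ → ℝ} {θ' t : ℝ} (h : HasDerivAt θ θ' t) :
    HasDerivAt (fun t => e (θ t)) (e (θ t) * (2 * Real.pi * Complex.I * θ')) t :=
  (h.ofReal_comp.const_mul (2 * Real.pi * Complex.I)).cexp

/-- The phase has derivative αt - β, of size at least |β|/2 on [0,1], so there is no stationary
point. One integration by parts leaves two boundary terms and a remainder, each at most 1/(π|β|),
and 3/π ≤ 1. -/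
theorem norm_osc_le {α β : ℝ} (γ : ℝ) (hβ : β ≠ 0) (h : 2 * |α| ≤ |β|) :
    ‖osc α β γ‖ ≤ 1 / |β| := by
  set θ : ℝ → ℝ := fun t => (1 / 2) * α * t ^ 2 - β * t + γ with hθ
  have hβ' : 0 < |β| := abs_pos.mpr hβ
  have hlow : ∀ t ∈ Set.Icc (0 : ℝ) 1, |β| / 2 ≤ |α * t - β| := by
    intro t ht
    have h1 : |α * t| ≤ |α| := by
      rw [abs_mul]
      exact mul_le_of_le_one_right (abs_nonneg _) (abs_le.mpr ⟨by linarith [ht.1], ht.2⟩)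
    have h2 := abs_sub_abs_le_abs_sub β (α * t)
    rw [abs_sub_comm] at h2
    linarith
  have hne : ∀ t ∈ Set.Icc (0 : ℝ) 1, ((α * t - β : ℝ) : ℂ) ≠ 0 := fun t ht =>
    Complex.ofReal_ne_zero.mpr (abs_pos.mp (lt_of_lt_of_le (by positivity) (hlow t ht)))
  have hpi : (2 * Real.pi * Complex.I : ℂ) ≠ 0 := Complex.two_pi_I_ne_zero
  set F : ℝ → ℂ := fun t => e (θ t) / (2 * Real.pi * Complex.I * ((α * t - β : ℝ) : ℂ)) with hF
  set R : ℝ → ℂ := fun t => e (θ t) * α / (2 * Real.pi * Complex.I * ((α * t - β : ℝ) : ℂ) ^ 2) with hR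
  have hθd : ∀ t, HasDerivAt θ (α * t - β) t := by
    intro t
    refine ((((hasDerivAt_pow 2 t).const_mul ((1 / 2) * α)).sub
      ((hasDerivAt_id' t).const_mul β)).add_const γ).congr_deriv ?_
    norm_num
    ring
  have hFd : ∀ t ∈ Set.uIcc (0 : ℝ) 1, HasDerivAt F (e (θ t) - R t) t := by
    intro t ht
    rw [Set.uIcc_of_le zero_le_one] at ht
    have h1 := hasDerivAt_e (hθd t)
    have h2 : HasDerivAt (fun t : ℝ => 2 * Real.pi * Complex.I * ((α * t - β : ℝ) : ℂ))
        (2 * Real.pi * Complex.I * α) t := by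
      have h3 : HasDerivAt (fun t : ℝ => α * t - β) α t := by
        simpa using ((hasDerivAt_id t).const_mul α).sub_const β
      exact h3.ofReal_comp.const_mul _
    have h4 := h1.div h2 (mul_ne_zero hpi (hne t ht))
    refine h4.congr_deriv ?_
    have := hne t ht
    simp only [hR]
    field_simp
  have hec : Continuous fun t => e (θ t) := continuous_e.comp (by fun_prop)
  have hRc : ContinuousOn R (Set.uIcc 0 1) := by
    rw [Set.uIcc_of_le zero_le_one]
    refine ContinuousOn.div (hec.mul continuous_const).continuousOn ?_ fun t ht => ?_
    · exact (Continuous.continuousOn (by fun_prop))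
    · exact mul_ne_zero hpi (pow_ne_zero 2 (hne t ht))
  have hint : ∫ t in (0 : ℝ)..1, (e (θ t) - R t) = F 1 - F 0 :=
    intervalIntegral.integral_eq_sub_of_hasDerivAt hFd
      ((hec.continuousOn.sub hRc).intervalIntegrable)
  rw [intervalIntegral.integral_sub (hec.intervalIntegrable _ _) hRc.intervalIntegrable] at hint
  have hosc : osc α β γ = F 1 - F 0 + ∫ t in (0 : ℝ)..1, R t := by
    rw [← hint]
    simp [osc, hθ]
  have hn : ‖(2 * Real.pi * Complex.I : ℂ)‖ = 2 * Real.pi := by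
    simp [Real.pi_pos.le]
  have hFb : ∀ t ∈ Set.Icc (0 : ℝ) 1, ‖F t‖ ≤ 1 / (Real.pi * |β|) := by
    intro t ht
    simp only [hF]
    rw [norm_div, norm_mul, hn, norm_e, Complex.norm_real, Real.norm_eq_abs]
    refine one_div_le_one_div_of_le (by positivity) ?_
    nlinarith [hlow t ht, Real.pi_pos]
  have hRb : ∀ t ∈ Set.uIoc (0 : ℝ) 1, ‖R t‖ ≤ 1 / (Real.pi * |β|) := by
    intro t ht
    rw [Set.uIoc_of_le zero_le_one] at ht
    have hl := hlow t ⟨ht.1.le, ht.2⟩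
    simp only [hR]
    rw [norm_div, norm_mul, norm_mul, hn, norm_e, norm_pow, Complex.norm_real, Complex.norm_real,
      Real.norm_eq_abs, Real.norm_eq_abs, one_mul]
    have hpos : 0 < |α * t - β| := lt_of_lt_of_le (by positivity) hl
    rw [div_le_div_iff₀ (by positivity) (by positivity)]
    have h5 : |α| * |β| ≤ 2 * |α * t - β| ^ 2 := by
      have : |α| * |β| ≤ (|β| / 2) * |β| := mul_le_mul_of_nonneg_right (by linarith) hβ'.le
      have h6 : (|β| / 2) ^ 2 ≤ |α * t - β| ^ 2 := pow_le_pow_left₀ (by positivity) hl 2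
      nlinarith
    nlinarith [Real.pi_pos]
  have hRi := intervalIntegral.norm_integral_le_of_norm_le_const hRb
  rw [sub_zero, abs_one, mul_one] at hRi
  rw [hosc]
  calc _ ≤ ‖F 1‖ + ‖F 0‖ + ‖∫ t in (0 : ℝ)..1, R t‖ :=
        (norm_add_le _ _).trans (add_le_add_left (norm_sub_le _ _) _)
    _ ≤ 1 / (Real.pi * |β|) + 1 / (Real.pi * |β|) + 1 / (Real.pi * |β|) :=
        add_le_add (add_le_add (hFb 1 (by simp)) (hFb 0 (by simp))) hRi
    _ = 3 / Real.pi * (1 / |β|) := by ring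
    _ ≤ 1 * (1 / |β|) := by
        refine mul_le_mul_of_nonneg_right ?_ (by positivity)
        rw [div_le_one Real.pi_pos]
        exact Real.pi_gt_three.le
    _ = _ := one_mul _

/-! ### The image of the indicator function under the Weil representation -/

/-- The image of `χ` under the operator of a matrix with lower left entry `c ≠ 0`. -/
def ker (a c d w : ℝ) : ℂ :=
  ((|c| ^ (-(1 / 2) : ℝ) : ℝ) : ℂ) * osc (d / c) (w / c) ((1 / 2) * a * w ^ 2 / c)

theorem sq_rpow_neg_half {x : ℝ} (hx : 0 ≤ x) : (x ^ (-(1 / 2) : ℝ)) ^ 2 = x⁻¹ := by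
  rw [← Real.rpow_natCast, ← Real.rpow_mul hx]
  norm_num
  exact Real.rpow_neg_one x

theorem norm_ker_sq (a c d w : ℝ) :
    ‖ker a c d w‖ ^ 2 = |c|⁻¹ * ‖osc (d / c) (w / c) ((1 / 2) * a * w ^ 2 / c)‖ ^ 2 := by
  rw [ker, norm_mul, mul_pow, Complex.norm_real, Real.norm_of_nonneg (by positivity),
    sq_rpow_neg_half (abs_nonneg c)]

theorem norm_ker_sq_le (a c d w : ℝ) : ‖ker a c d w‖ ^ 2 ≤ |c|⁻¹ := by
  rw [norm_ker_sq]
  exact mul_le_of_le_one_right (by positivity)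
    (pow_le_one₀ (norm_nonneg _) (norm_osc_le_one _ _ _))

theorem norm_ker_sq_le_tail {a c d w : ℝ} (hc : c ≠ 0) (hw : w ≠ 0) (h : 2 * |d| ≤ |w|) :
    ‖ker a c d w‖ ^ 2 ≤ |c| / w ^ 2 := by
  have hc' : 0 < |c| := abs_pos.mpr hc
  rw [norm_ker_sq]
  have h1 := norm_osc_le (α := d / c) (β := w / c) ((1 / 2) * a * w ^ 2 / c) (div_ne_zero hw hc) (by
    rw [abs_div, abs_div, ← mul_div_assoc]
    exact div_le_div_of_nonneg_right h hc'.le)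
  rw [abs_div, one_div_div] at h1
  calc _ ≤ |c|⁻¹ * (|c| / |w|) ^ 2 := by gcongr
    _ = _ := by
      rw [div_pow, sq_abs w]
      field_simp

/-- The trivial bound serves for |w| < 2A, the integration by parts beyond. The constant depends
only on c₀ and A, which makes it a local dominating function in M. -/
theorem norm_ker_sq_le_of_bounds {a c d c₀ A : ℝ} (hA : 1 ≤ A) (hc₀ : 0 < c₀) (hc : c₀ ≤ |c|)
    (hcA : |c| ≤ A) (hd : |d| ≤ A) (w : ℝ) :
    ‖ker a c d w‖ ^ 2 ≤ (2 * A + (1 + 4 * A ^ 2) / c₀) * (1 + w ^ 2)⁻¹ := by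
  have h0 : 0 < 1 + w ^ 2 := by positivity
  rw [← div_eq_mul_inv, le_div_iff₀ h0]
  by_cases hw : 2 * A ≤ |w|
  · have hw2 : 1 ≤ w ^ 2 := by
      rw [← sq_abs]
      nlinarith
    have h1 := norm_ker_sq_le_tail (a := a) (abs_pos.mp (hc₀.trans_le hc))
      (abs_pos.mp (by linarith : 0 < |w|)) (by linarith : 2 * |d| ≤ |w|)
    rw [le_div_iff₀ (by positivity)] at h1
    have h2 : ‖ker a c d w‖ ^ 2 * (1 + w ^ 2) ≤ 2 * (‖ker a c d w‖ ^ 2 * w ^ 2) := by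
      nlinarith [sq_nonneg ‖ker a c d w‖]
    have : 0 ≤ (1 + 4 * A ^ 2) / c₀ := by positivity
    linarith
  · push Not at hw
    have h1 := norm_ker_sq_le a c d w
    have hi : |c|⁻¹ ≤ c₀⁻¹ := inv_anti₀ hc₀ hc
    have hw2 : 1 + w ^ 2 ≤ 1 + 4 * A ^ 2 := by
      rw [← sq_abs]
      nlinarith [abs_nonneg w]
    calc _ ≤ c₀⁻¹ * (1 + 4 * A ^ 2) := by gcongr; exact h1.trans hi
      _ = (1 + 4 * A ^ 2) / c₀ := by ring
      _ ≤ _ := by linarith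

theorem continuous_ker (a c d : ℝ) : Continuous (ker a c d) := by
  unfold ker
  exact continuous_const.mul (continuous_osc.comp
    (f := fun w : ℝ => (d / c, w / c, (1 / 2) * a * w ^ 2 / c)) (by fun_prop))

theorem continuousAt_ker {a c d : ℝ} (hc : c ≠ 0) (w : ℝ) :
    ContinuousAt (fun p : ℝ × ℝ × ℝ => ker p.1 p.2.1 p.2.2 w) (a, c, d) := by
  unfold ker
  refine ContinuousAt.mul ?_ (continuous_osc.continuousAt.comp (x := (a, c, d))
    (f := fun p : ℝ × ℝ × ℝ => (p.2.2 / p.2.1, w / p.2.1, (1 / 2) * p.1 * w ^ 2 / p.2.1)) ?_)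
  · refine Complex.continuous_ofReal.continuousAt.comp ?_
    refine ContinuousAt.rpow_const (by fun_prop) (Or.inl (abs_ne_zero.mpr hc))
  · have : ((a, c, d) : ℝ × ℝ × ℝ).2.1 ≠ 0 := hc
    fun_prop (disch := assumption)

/-- The image of `χ` under the operator of `M` in the Weil representation, up to a phase. -/
def weil (M : SL(2, ℝ)) (w : ℝ) : ℂ :=
  ((iwV M ^ (1 / 4 : ℝ) : ℝ) : ℂ) * rot chi (iwPhi M) (w * Real.sqrt (iwV M)) *
    e ((1 / 2) * w ^ 2 * iwU M)

theorem thetaTerm_eq_zakTerm (M : SL(2, ℝ)) (n : ℤ) : thetaTerm chi M n = zakTerm (weil M) n := by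
  ext p
  rw [thetaTerm, zakTerm, weil, e_add]
  ring

theorem measurable_weil (M : SL(2, ℝ)) : Measurable (weil M) := by
  unfold weil
  exact (((measurable_rot_chi _).comp (by fun_prop)).const_mul _).mul
    (continuous_e.measurable.comp (by fun_prop))

section Iwasawa

variable (M : SL(2, ℝ))

theorem det_eq : M.1 0 0 * M.1 1 1 - M.1 0 1 * M.1 1 0 = 1 := by
  rw [← Matrix.det_fin_two]
  exact M.2

theorem sqrt_iwV : Real.sqrt (iwV M) = 1 / Real.sqrt (M.1 1 0 ^ 2 + M.1 1 1 ^ 2) := by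
  rw [iwV, Real.sqrt_div zero_le_one, Real.sqrt_one]

theorem norm_row : ‖(⟨M.1 1 1, M.1 1 0⟩ : ℂ)‖ = Real.sqrt (M.1 1 0 ^ 2 + M.1 1 1 ^ 2) := by
  rw [Complex.norm_def, Complex.normSq_mk]
  congr 1
  ring

theorem row_ne_zero : (⟨M.1 1 1, M.1 1 0⟩ : ℂ) ≠ 0 := by
  rw [← norm_pos_iff, norm_row]
  exact Real.sqrt_pos.mpr (row_pos M)

theorem cos_iwPhi : Real.cos (iwPhi M) = M.1 1 1 / Real.sqrt (M.1 1 0 ^ 2 + M.1 1 1 ^ 2) := by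
  rw [iwPhi, Complex.cos_arg (row_ne_zero M), norm_row]

theorem sin_iwPhi : Real.sin (iwPhi M) = M.1 1 0 / Real.sqrt (M.1 1 0 ^ 2 + M.1 1 1 ^ 2) := by
  rw [iwPhi, Complex.sin_arg, norm_row]

end Iwasawa

/-- In Iwasawa coordinates cot φ = d/c, v^{1/2}/sin φ = 1/c and, by the determinant, u + v cot φ =
a/c. The powers of v and |sin φ| combine to |c|^{-1/2}. -/
theorem weil_eq_ker {M : SL(2, ℝ)} (hc : M.1 1 0 ≠ 0) (w : ℝ) :
    weil M w = ker (M.1 0 0) (M.1 1 0) (M.1 1 1) w := by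
  have hdet := det_eq M
  have hr := row_pos M
  have hs := sin_iwPhi M
  have hco := cos_iwPhi M
  have hv := sqrt_iwV M
  set r := Real.sqrt (M.1 1 0 ^ 2 + M.1 1 1 ^ 2) with hrdef
  have hr0 : 0 < r := Real.sqrt_pos.mpr hr
  have hr2 : r ^ 2 = M.1 1 0 ^ 2 + M.1 1 1 ^ 2 := Real.sq_sqrt hr.le
  have hsin : Real.sin (iwPhi M) ≠ 0 := by
    rw [hs]
    exact div_ne_zero hc hr0.ne'
  have hang : ¬ ((iwPhi M : Real.Angle) = 0 ∨ (iwPhi M : Real.Angle) = (Real.pi : Real.Angle)) := by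
    rw [← Real.Angle.sin_eq_zero_iff]
    simpa using hsin
  push Not at hang
  have hpow : iwV M ^ (1 / 4 : ℝ) * |Real.sin (iwPhi M)| ^ (-(1 / 2) : ℝ) =
      |M.1 1 0| ^ (-(1 / 2) : ℝ) := by
    have h1 : iwV M ^ (1 / 4 : ℝ) = r ^ (-(1 / 2) : ℝ) := by
      have : iwV M = r ^ (-2 : ℝ) := by
        rw [iwV, ← hr2, Real.rpow_neg hr0.le, one_div]
        norm_cast
      rw [this, ← Real.rpow_mul hr0.le]
      norm_num
    rw [h1, hs, abs_div, abs_of_pos hr0, ← Real.mul_rpow hr0.le (by positivity)]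
    congr 1
    field_simp
  rw [weil, rot, if_neg hang.1, if_neg hang.2, ker, ← hpow, osc]
  push_cast
  have hint : (∫ w' : ℝ, e (((1 / 2) * ((w * Real.sqrt (iwV M)) ^ 2 + w' ^ 2) * Real.cos (iwPhi M) -
      w * Real.sqrt (iwV M) * w') / Real.sin (iwPhi M)) * chi w') * e ((1 / 2) * w ^ 2 * iwU M) =
      ∫ t in (0 : ℝ)..1, e ((1 / 2) * (M.1 1 1 / M.1 1 0) * t ^ 2 - (w / M.1 1 0) * t +
        (1 / 2) * M.1 0 0 * w ^ 2 / M.1 1 0) := by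
    rw [← integral_mul_const, intervalIntegral.integral_of_le zero_le_one,
      ← integral_indicator measurableSet_Ioc]
    refine integral_congr_ae (Eventually.of_forall fun t => ?_)
    by_cases ht : t ∈ Set.Ioc (0 : ℝ) 1
    · simp only [chi, Set.indicator_of_mem ht, mul_one]
      rw [← e_add, hs, hco, hv, iwU, ← hr2]
      congr 1
      field_simp
      linear_combination w ^ 2 * (-M.1 1 1 * hdet - M.1 0 0 * hr2)
    · simp [chi, Set.indicator_of_notMem ht]
  linear_combination (((iwV M ^ (1 / 4 : ℝ) : ℝ) : ℂ) *
    ((|Real.sin (iwPhi M)| ^ (-(1 / 2) : ℝ) : ℝ) : ℂ)) * hint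

/-- For upper triangular M one has |a| = v^{1/2}, and the sign of a tells φ = 0 from φ = π. -/
theorem weil_eq_chi {M : SL(2, ℝ)} (hc : M.1 1 0 = 0) (w : ℝ) :
    weil M w = ((|M.1 0 0| ^ (1 / 2 : ℝ) : ℝ) : ℂ) * chi (M.1 0 0 * w) *
      e ((1 / 2) * (M.1 0 0 * M.1 0 1) * w ^ 2) := by
  have hdet := det_eq M
  rw [hc, mul_zero, sub_zero] at hdet
  have ha : M.1 0 0 ≠ 0 := left_ne_zero_of_mul_eq_one hdet
  have hd : M.1 1 1 = (M.1 0 0)⁻¹ := eq_inv_of_mul_eq_one_right hdet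
  have hv : iwV M = M.1 0 0 ^ 2 := by
    rw [iwV, hc, hd]
    simp
  have hu : iwU M = M.1 0 0 * M.1 0 1 := by
    rw [iwU, hc, hd]
    field_simp
    ring
  have hpow : (M.1 0 0 ^ 2) ^ (1 / 4 : ℝ) = |M.1 0 0| ^ (1 / 2 : ℝ) := by
    rw [← sq_abs, ← Real.rpow_natCast, ← Real.rpow_mul (abs_nonneg _)]
    norm_num
  have hrot : rot chi (iwPhi M) (w * |M.1 0 0|) = chi (M.1 0 0 * w) := by
    rcases lt_or_gt_of_ne ha with h | h
    · have hphi : iwPhi M = Real.pi := by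
        rw [iwPhi, Complex.arg_eq_pi_iff]
        exact ⟨by rw [hd]; exact inv_lt_zero.mpr h, hc⟩
      rw [rot, if_neg, if_pos (by rw [hphi]), abs_of_neg h]
      · congr 1
        ring
      · rw [hphi]
        exact Real.Angle.pi_ne_zero
    · have hphi : iwPhi M = 0 := by
        rw [iwPhi, Complex.arg_eq_zero_iff]
        exact ⟨by rw [hd]; exact (inv_pos.mpr h).le, hc⟩
      rw [rot, if_pos (by rw [hphi]; rfl), abs_of_pos h, mul_comm]
  rw [weil, hv, Real.sqrt_sq_eq_abs, hrot, hpow, hu]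
  congr 2
  ring

theorem decay_weil {M : SL(2, ℝ)} (hc : M.1 1 0 = 0) :
    Decay (weil M) (|M.1 0 0| ^ (1 / 2 : ℝ) * (1 + (M.1 0 0)⁻¹ ^ 2)) := by
  refine ⟨measurable_weil M, fun w => ?_⟩
  have hdet := det_eq M
  rw [hc, mul_zero, sub_zero] at hdet
  have ha : M.1 0 0 ≠ 0 := left_ne_zero_of_mul_eq_one hdet
  rw [weil_eq_chi hc, norm_mul, norm_mul, norm_e, mul_one, Complex.norm_real,
    Real.norm_of_nonneg (by positivity), mul_assoc]
  refine mul_le_mul_of_nonneg_left ?_ (by positivity)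
  rw [chi]
  by_cases h : M.1 0 0 * w ∈ Set.Ioc (0 : ℝ) 1
  · rw [Set.indicator_of_mem h, norm_one, ← div_eq_mul_inv, one_le_div (by positivity)]
    have h2 : (M.1 0 0 * w) ^ 2 ≤ 1 := pow_le_one₀ h.1.le h.2
    have h3 : w ^ 2 = (M.1 0 0)⁻¹ ^ 2 * (M.1 0 0 * w) ^ 2 := by field_simp
    have h4 : (M.1 0 0)⁻¹ ^ 2 * (M.1 0 0 * w) ^ 2 ≤ (M.1 0 0)⁻¹ ^ 2 :=
      mul_le_of_le_one_right (sq_nonneg _) h2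
    linarith
  · rw [Set.indicator_of_notMem h, norm_zero]
    positivity

theorem sqInt_ker {a c d : ℝ} (hc : c ≠ 0) : SqInt (ker a c d) :=
  SqInt.of_bound (continuous_ker a c d).measurable
    (norm_ker_sq_le_of_bounds (A := 1 + |c| + |d|) (by linarith [abs_nonneg c, abs_nonneg d])
      (abs_pos.mpr hc) le_rfl (by linarith [abs_nonneg d]) (by linarith [abs_nonneg c]))

theorem sqInt_weil (M : SL(2, ℝ)) : SqInt (weil M) := by
  by_cases hc : M.1 1 0 = 0
  · exact (decay_weil hc).sqInt
  · rw [funext (weil_eq_ker hc)]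
    exact sqInt_ker hc

theorem thetaTermLp_eq (M : SL(2, ℝ)) : thetaTermLp M = (sqInt_weil M).zakTermLp := by
  ext1 n
  rw [thetaTermLp, SqInt.zakTermLp]
  congr 1
  exact thetaTerm_eq_zakTerm M n

theorem nuG_eq_law (M : SL(2, ℝ)) : nuG M = law (sqInt_weil M).zak := by
  rw [SqInt.zak, ← thetaTermLp_eq]
  rfl

/-! ### Limits in `L²` -/

theorem tendsto_lintegral_sub_of_dominated {ι : Type*} {l : Filter ι} [l.IsCountablyGenerated]
    {G : ι → ℝ → ℂ} {g : ℝ → ℂ} {C : ℝ} (hG : ∀ᶠ i in l, Measurable (G i))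
    (hb : ∀ᶠ i in l, ∀ w, ‖G i w‖ ^ 2 ≤ C * (1 + w ^ 2)⁻¹)
    (hb' : ∀ w, ‖g w‖ ^ 2 ≤ C * (1 + w ^ 2)⁻¹) (hg : Measurable g)
    (h : ∀ w, Tendsto (fun i => G i w) l (𝓝 (g w))) :
    Tendsto (fun i => ∫⁻ w, ‖G i w - g w‖ₑ ^ 2) l (𝓝 0) := by
  have := tendsto_lintegral_filter_of_dominated_convergence (μ := (volume : Measure ℝ)) (l := l)
    (F := fun i w => ‖G i w - g w‖ₑ ^ 2) (f := fun _ => 0)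
    (fun w : ℝ => ENNReal.ofReal (4 * C * (1 + w ^ 2)⁻¹))
    (by filter_upwards [hG] with i hi using (hi.sub hg).enorm.pow_const _)
    (by
      filter_upwards [hb] with i hi
      refine Eventually.of_forall fun w => enorm_sq_le_ofReal ?_
      have h1 := hi w
      have h2 := hb' w
      have h3 : ‖G i w - g w‖ ^ 2 ≤ (‖G i w‖ + ‖g w‖) ^ 2 :=
        pow_le_pow_left₀ (norm_nonneg _) (norm_sub_le _ _) 2
      nlinarith [sq_nonneg (‖G i w‖ - ‖g w‖)])
    (lintegral_ofReal_decay_ne_top _)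
    (Eventually.of_forall fun w => by
      have h1 : Tendsto (fun i => G i w - g w) l (𝓝 0) := by
        simpa using (h w).sub_const (g w)
      have h2 := ((ENNReal.continuous_pow 2).tendsto _).comp ((continuous_enorm.tendsto _).comp h1)
      simpa [Function.comp_def] using h2)
  simpa using this

theorem Decay.sub {h k : ℝ → ℂ} {C D : ℝ} (hh : Decay h C) (hk : Decay k D) :
    Decay (h - k) (C + D) :=
  ⟨hh.meas.sub hk.meas, fun w => (norm_sub_le _ _).trans
    ((add_le_add (hh.bound w) (hk.bound w)).trans_eq (by ring))⟩

theorem Decay.ft_sub {h k : ℝ → ℂ} {C D : ℝ} (hh : Decay h C) (hk : Decay k D) :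
    ft (h - k) = ft h - ft k := by
  ext η
  have hi : ∀ {h : ℝ → ℂ} {C : ℝ}, Decay h C → Integrable fun t => h t * e (-(t * η)) := fun hh =>
    hh.integrable.mul_bdd (c := 1) (continuous_e.comp (by fun_prop)).aestronglyMeasurable
      (Eventually.of_forall fun x => (norm_e _).le)
  rw [Pi.sub_apply, ft, ft, ft, ← integral_sub (hi hh) (hi hk)]
  simp [sub_mul]

theorem Decay.eLpNorm_ft {h : ℝ → ℂ} {C : ℝ} (hh : Decay h C) :
    eLpNorm (ft h) 2 volume = eLpNorm h 2 volume := by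
  have := hh.lintegral_ft
  rw [← eLpNorm_two_sq, ← eLpNorm_two_sq] at this
  exact (ENNReal.pow_right_strictMono two_ne_zero).injective this

theorem tendsto_sq_iff {ι : Type*} {l : Filter ι} {f : ι → ENNReal} :
    Tendsto (fun i => f i ^ 2) l (𝓝 0) ↔ Tendsto f l (𝓝 0) := by
  constructor <;> intro h
  · have h' := h.ennrpow_const (1 / 2 : ℝ)
    rw [ENNReal.zero_rpow_of_pos (by norm_num)] at h'
    refine h'.congr fun i => ?_
    rw [← ENNReal.rpow_natCast, ← ENNReal.rpow_mul]
    norm_num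
  · simpa [Function.comp_def] using ((ENNReal.continuous_pow 2).tendsto 0).comp h

/-- If `H n → h` in `L²` and the Fourier transforms of `H n` converge pointwise to `k`, then
`h` and `k` have Zak transforms with the same law. -/
theorem law_zak_eq_of_tendsto_ft {H : ℕ → ℝ → ℂ} {C : ℕ → ℝ} (hH : ∀ n, Decay (H n) (C n))
    {h k : ℝ → ℂ} (hh : SqInt h) (hk : SqInt k)
    (hlim : Tendsto (fun n => ∫⁻ w, ‖H n w - h w‖ₑ ^ 2) atTop (𝓝 0))
    (hpt : ∀ η, Tendsto (fun n => ft (H n) η) atTop (𝓝 (k η))) :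
    law hk.zak = law hh.zak := by
  have hE : Tendsto (fun n => eLpNorm (H n - h) 2 volume) atTop (𝓝 0) := by
    rw [← tendsto_sq_iff]
    simpa only [eLpNorm_two_sq, Pi.sub_apply] using hlim
  -- By Fatou, the norm of the pointwise limit `ft (H n) - k` is controlled by the norms of `ft (H
  -- n) - ft (H m)` for large m, which Plancherel equates with those of `H n - H m`.
  have hle : ∀ n, eLpNorm (ft (H n) - k) 2 volume ≤ eLpNorm (H n - h) 2 volume := by
    intro n
    refine ENNReal.le_of_forall_pos_le_add fun δ hδ _ => ?_
    refine Lp.eLpNorm_le_of_ae_tendsto (u := atTop) (f := fun m => ft (H n) - ft (H m)) ?_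
      (fun m => ((measurable_ft (hH n).meas).sub (measurable_ft (hH m).meas)).aestronglyMeasurable)
      (Eventually.of_forall fun η => (hpt η).const_sub _)
    filter_upwards [hE.eventually (gt_mem_nhds (ENNReal.coe_pos.mpr hδ))] with m hm
    rw [← (hH n).ft_sub (hH m), ((hH n).sub (hH m)).eLpNorm_ft,
      show H n - H m = (H n - h) - (H m - h) by abel]
    refine (eLpNorm_sub_le ((hH n).meas.sub hh.meas).aestronglyMeasurable
      ((hH m).meas.sub hh.meas).aestronglyMeasurable one_le_two).trans ?_
    gcongr
  have hlim' : Tendsto (fun n => ∫⁻ w, ‖ft (H n) w - k w‖ₑ ^ 2) atTop (𝓝 0) := by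
    have h1 := tendsto_of_tendsto_of_tendsto_of_le_of_le tendsto_const_nhds hE
      (fun _ => zero_le) hle
    rw [← tendsto_sq_iff] at h1
    simpa only [eLpNorm_two_sq, Pi.sub_apply] using h1
  have t1 := tendsto_law (SqInt.tendsto_zak (fun n => (hH n).sqInt_ft) hk hlim')
  have t2 := tendsto_law (SqInt.tendsto_zak (fun n => (hH n).sqInt) hh hlim)
  simp_rw [(hH _).law_zak_ft] at t1
  exact tendsto_nhds_unique t1 t2

/-! ### The Fourier transform of the image of `χ` -/

/-- `ker` with a Gaussian factor. -/
def damped (ε a c d w : ℝ) : ℂ := ((Real.exp (-(Real.pi * ε) * w ^ 2) : ℝ) : ℂ) * ker a c d w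

/-- The available bound of order 1/|w| for `ker` is too weak for Poisson summation; the Gaussian
factor, through exp(-x) ≤ 1/(1 + x), supplies the required decay. -/
theorem decay_damped {ε : ℝ} (hε : 0 < ε) (a c d : ℝ) :
    Decay (damped ε a c d) ((1 + (Real.pi * ε)⁻¹) * |c| ^ (-(1 / 2) : ℝ)) := by
  refine ⟨?_, fun w => ?_⟩
  · unfold damped
    exact (by fun_prop : Measurable fun w : ℝ => ((Real.exp (-(Real.pi * ε) * w ^ 2) : ℝ) : ℂ)).mul
      (continuous_ker a c d).measurable
  · have hp : 0 < Real.pi * ε := by positivity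
    have h1 : ‖ker a c d w‖ ≤ |c| ^ (-(1 / 2) : ℝ) := by
      rw [ker, norm_mul, Complex.norm_real, Real.norm_of_nonneg (by positivity)]
      exact mul_le_of_le_one_right (by positivity) (norm_osc_le_one _ _ _)
    have h2 : Real.exp (-(Real.pi * ε) * w ^ 2) ≤ (1 + (Real.pi * ε)⁻¹) * (1 + w ^ 2)⁻¹ := by
      rw [neg_mul, Real.exp_neg, ← div_eq_mul_inv, inv_le_comm₀ (Real.exp_pos _) (by positivity),
        inv_div]
      refine le_trans ?_ (Real.add_one_le_exp _)
      rw [div_le_iff₀ (by positivity)]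
      have : (Real.pi * ε * w ^ 2 + 1) * (1 + (Real.pi * ε)⁻¹) =
          1 + w ^ 2 + Real.pi * ε * w ^ 2 + (Real.pi * ε)⁻¹ := by
        field_simp
        ring
      rw [this]
      have : 0 ≤ Real.pi * ε * w ^ 2 := by positivity
      have : 0 < (Real.pi * ε)⁻¹ := by positivity
      linarith
    rw [damped, norm_mul, Complex.norm_real, Real.norm_of_nonneg (Real.exp_pos _).le]
    calc _ ≤ ((1 + (Real.pi * ε)⁻¹) * (1 + w ^ 2)⁻¹) * |c| ^ (-(1 / 2) : ℝ) := by gcongr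
      _ = _ := by ring

theorem tendsto_damped {a c d : ℝ} (hc : c ≠ 0) {ε : ℕ → ℝ} (hε : ∀ n, 0 < ε n)
    (hlim : Tendsto ε atTop (𝓝 0)) :
    Tendsto (fun n => ∫⁻ w, ‖damped (ε n) a c d w - ker a c d w‖ₑ ^ 2) atTop (𝓝 0) := by
  have hb := norm_ker_sq_le_of_bounds (a := a) (c := c) (d := d) (A := 1 + |c| + |d|)
    (by linarith [abs_nonneg c, abs_nonneg d])
    (abs_pos.mpr hc) le_rfl (by linarith [abs_nonneg d]) (by linarith [abs_nonneg c])
  refine tendsto_lintegral_sub_of_dominated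
    (Eventually.of_forall fun n => (decay_damped (hε n) a c d).meas)
    (Eventually.of_forall fun n w => le_trans ?_ (hb w)) hb (continuous_ker a c d).measurable
    fun w => ?_
  · rw [damped, norm_mul, Complex.norm_real, Real.norm_of_nonneg (Real.exp_pos _).le]
    refine pow_le_pow_left₀ (by positivity) (mul_le_of_le_one_left (norm_nonneg _) ?_) 2
    rw [Real.exp_le_one_iff, neg_mul, neg_nonpos]
    have := (hε n).le
    positivity
  · have h1 : Continuous fun ε : ℝ => damped ε a c d w := by
      unfold damped
      fun_prop
    have h2 := (h1.tendsto 0).comp hlim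
    simpa [damped, Function.comp_def] using h2

/-- The integral over `t ∈ [0,1]` in the Fourier transform of `damped`. -/
def gaussInt (c d η : ℝ) (z : ℂ) : ℂ :=
  ∫ t in (0 : ℝ)..1, e ((1 / 2) * (d / c) * t ^ 2) *
    Complex.exp (-(Real.pi * ((η + t / c : ℝ) : ℂ) ^ 2 * z))

theorem continuous_gaussInt (c d η : ℝ) : Continuous (gaussInt c d η) := by
  refine intervalIntegral.continuous_parametric_intervalIntegral_of_continuous' ?_ 0 1
  unfold Function.uncurry
  exact (continuous_e.comp (by fun_prop)).mul (by fun_prop)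

/-- After Fubini the integral over w is Gaussian, with complex parameter ε - i a/c and frequency η +
t/c. Only an integral over t ∈ [0,1] remains, and it stays continuous as ε → 0. -/
theorem ft_damped {ε : ℝ} (hε : 0 < ε) (a c d η : ℝ) :
    ft (damped ε a c d) η = ((|c| ^ (-(1 / 2) : ℝ) : ℝ) : ℂ) *
      ((((ε : ℂ) - (a / c : ℝ) * Complex.I)⁻¹) ^ (1 / 2 : ℂ) *
        gaussInt c d η (((ε : ℂ) - (a / c : ℝ) * Complex.I)⁻¹)) := by
  set τ : ℂ := (ε : ℂ) - (a / c : ℝ) * Complex.I with hτ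
  have hτre : τ.re = ε := by simp [hτ]
  have hτ0 : τ ≠ 0 := fun h => by
    rw [h, Complex.zero_re] at hτre
    exact hε.ne hτre
  set F : ℝ → ℝ → ℂ := fun w t => ((Real.exp (-(Real.pi * ε) * w ^ 2) : ℝ) : ℂ) *
    e ((1 / 2) * (d / c) * t ^ 2 - w / c * t + (1 / 2) * a * w ^ 2 / c) * e (-(w * η)) with hF
  have h1 : ft (damped ε a c d) η = ((|c| ^ (-(1 / 2) : ℝ) : ℝ) : ℂ) * ∫ w, ∫ t, F w t ∂unif := by
    rw [ft, ← integral_const_mul]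
    refine integral_congr_ae (Eventually.of_forall fun w => ?_)
    simp only [hF, damped, ker, osc]
    rw [integral_mul_const, integral_const_mul, intervalIntegral.integral_of_le zero_le_one,
      restrict_Ioc_eq_unif]
    ring
  have hFi : Integrable (Function.uncurry F) (volume.prod unif) := by
    have hg : Integrable (fun p : ℝ × ℝ => Real.exp (-(Real.pi * ε) * p.1 ^ 2)) (volume.prod unif) :=
      (integrable_exp_neg_mul_sq (by positivity : 0 < Real.pi * ε)).comp_fst unif
    refine hg.mono' ?_ (Eventually.of_forall fun p => ?_)
    · refine Continuous.aestronglyMeasurable ?_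
      simp only [hF, Function.uncurry_def]
      exact ((by fun_prop : Continuous fun p : ℝ × ℝ => ((Real.exp (-(Real.pi * ε) * p.1 ^ 2) : ℝ) : ℂ)).mul
        (continuous_e.comp (by fun_prop))).mul (continuous_e.comp (by fun_prop))
    · simp only [hF, Function.uncurry_def]
      rw [norm_mul, norm_mul, norm_e, norm_e, mul_one, mul_one, Complex.norm_real,
        Real.norm_of_nonneg (Real.exp_pos _).le]
  rw [h1, integral_integral_swap hFi, gaussInt, intervalIntegral.integral_of_le zero_le_one,
    restrict_Ioc_eq_unif, ← integral_const_mul (τ⁻¹ ^ (1 / 2 : ℂ))]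
  congr 1
  refine integral_congr_ae (Eventually.of_forall fun t => ?_)
  have h2 : ∀ w : ℝ, F w t = Complex.exp ((-(Real.pi * τ)) * w ^ 2 +
      (-(2 * Real.pi * Complex.I * ((η + t / c : ℝ) : ℂ))) * w +
      2 * Real.pi * Complex.I * (((1 / 2) * (d / c) * t ^ 2 : ℝ) : ℂ)) := by
    intro w
    simp only [hF, e]
    rw [Complex.ofReal_exp, ← Complex.exp_add, ← Complex.exp_add, hτ]
    congr 1
    push_cast
    ring
  simp only
  simp_rw [h2]
  rw [integral_cexp_quadratic (by simp [hτre]; positivity), neg_neg]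
  have hpi : (Real.pi : ℂ) ≠ 0 := Complex.ofReal_ne_zero.mpr Real.pi_ne_zero
  rw [show (Real.pi : ℂ) / (Real.pi * τ) = τ⁻¹ by field_simp, e, ← Complex.exp_add]
  congr 2
  rw [sub_eq_add_neg]
  congr 2
  field_simp
  ring_nf
  simp only [Complex.I_sq]
  ring

/-- The Fourier transform of the kernel of M is, up to a phase, the kernel of SM, whose bottom row
is (a, b). Poisson summation is applied to the damped kernels, and ε → 0. -/
theorem law_zak_ker {a b c d : ℝ} (ha : a ≠ 0) (hc : c ≠ 0) (hdet : a * d - b * c = 1) :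
    law (sqInt_ker (a := -c) (d := b) ha).zak = law (sqInt_ker (a := a) (d := d) hc).zak := by
  -- The limit of (ε - i a/c)⁻¹ as ε → 0. The factor κ collects what the Gaussian integral leaves
  -- over, and has modulus 1.
  set z₀ : ℂ := ((c / a : ℝ) : ℂ) * Complex.I with hz₀
  set κ : ℂ := ((|c| ^ (-(1 / 2) : ℝ) : ℝ) : ℂ) * z₀ ^ (1 / 2 : ℂ) * ((|a| ^ (1 / 2 : ℝ) : ℝ) : ℂ) with hκ
  have hzn : ‖z₀‖ = |c| / |a| := by
    simp [hz₀]
  have hκn : ‖κ‖ = 1 := by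
    have h1 : ‖z₀ ^ (1 / 2 : ℂ)‖ = (|c| / |a|) ^ (1 / 2 : ℝ) := by
      rw [← hzn, ← Complex.norm_cpow_real]
      norm_num
    rw [hκ, norm_mul, norm_mul, h1, Complex.norm_real, Complex.norm_real,
      Real.norm_of_nonneg (by positivity), Real.norm_of_nonneg (by positivity),
      Real.div_rpow (abs_nonneg _) (abs_nonneg _), Real.rpow_neg (abs_nonneg _)]
    have h2 : |c| ^ (1 / 2 : ℝ) ≠ 0 := (Real.rpow_pos_of_pos (abs_pos.mpr hc) _).ne'
    have h3 : |a| ^ (1 / 2 : ℝ) ≠ 0 := (Real.rpow_pos_of_pos (abs_pos.mpr ha) _).ne'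
    field_simp
  have hk : SqInt fun w => κ * ker (-c) a b w :=
    .of_memLp ((continuous_ker _ _ _).measurable.const_mul _) ((sqInt_ker ha).memLp.const_mul κ)
  rw [← law_zak_phase (sqInt_ker (a := -c) (d := b) ha) hk hκn fun w => rfl]
  set ε : ℕ → ℝ := fun n => 1 / ((n : ℝ) + 1) with hεdef
  have hε : ∀ n, 0 < ε n := fun n => by positivity
  have hlim : Tendsto ε atTop (𝓝 0) := tendsto_one_div_add_atTop_nhds_zero_nat
  refine law_zak_eq_of_tendsto_ft (fun n => decay_damped (hε n) a c d) _ hk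
    (tendsto_damped hc hε hlim) fun η => ?_
  simp_rw [ft_damped (hε _)]
  have hz : Tendsto (fun n => ((ε n : ℂ) - (a / c : ℝ) * Complex.I)⁻¹) atTop (𝓝 z₀) := by
    have h1 : Tendsto (fun n => (ε n : ℂ) - (a / c : ℝ) * Complex.I) atTop
        (𝓝 (((0 : ℝ) : ℂ) - (a / c : ℝ) * Complex.I)) :=
      ((Complex.continuous_ofReal.tendsto 0).comp hlim).sub_const _
    have ha' : (a : ℂ) ≠ 0 := Complex.ofReal_ne_zero.mpr ha
    have hc' : (c : ℂ) ≠ 0 := Complex.ofReal_ne_zero.mpr hc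
    have h2 : ((0 : ℝ) : ℂ) - (a / c : ℝ) * Complex.I ≠ 0 := by
      simp [ha, hc]
    have h3 := h1.inv₀ h2
    convert h3 using 2
    refine eq_inv_of_mul_eq_one_left ?_
    rw [hz₀]
    push_cast
    field_simp
    ring_nf
    simp
  -- Being purely imaginary and nonzero, z₀ is off the branch cut, so the square root is continuous
  -- there.
  have hslit : z₀ ∈ Complex.slitPlane := by
    rw [Complex.mem_slitPlane_iff]
    right
    simp [hz₀, ha, hc]
  have hk2 : κ * ker (-c) a b η =
      ((|c| ^ (-(1 / 2) : ℝ) : ℝ) : ℂ) * (z₀ ^ (1 / 2 : ℂ) * gaussInt c d η z₀) := by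
    have hg : gaussInt c d η z₀ = osc (b / a) (η / a) ((1 / 2) * (-c) * η ^ 2 / a) := by
      rw [gaussInt, osc]
      congr 1
      ext t
      have : Complex.exp (-(Real.pi * ((η + t / c : ℝ) : ℂ) ^ 2 * z₀)) =
          e (-((1 / 2) * (c / a) * (η + t / c) ^ 2)) := by
        rw [e, hz₀]
        push_cast
        ring_nf
      rw [this, ← e_add]
      congr 1
      field_simp
      linear_combination t ^ 2 * hdet
    have hm : ((|a| ^ (1 / 2 : ℝ) : ℝ) : ℂ) * ((|a| ^ (-(1 / 2) : ℝ) : ℝ) : ℂ) = 1 := by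
      rw [← Complex.ofReal_mul, ← Real.rpow_add (abs_pos.mpr ha)]
      norm_num
    rw [hg, hκ, ker]
    linear_combination (((|c| ^ (-(1 / 2) : ℝ) : ℝ) : ℂ) * z₀ ^ (1 / 2 : ℂ) *
      osc (b / a) (η / a) ((1 / 2) * (-c) * η ^ 2 / a)) * hm
  rw [hk2]
  refine Tendsto.const_mul _ (Tendsto.mul ?_ (((continuous_gaussInt c d η).tendsto _).comp hz))
  exact (continuousAt_cpow_const hslit).tendsto.comp hz

theorem ft_weil {M : SL(2, ℝ)} (hc : M.1 1 0 = 0) :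
    ft (weil M) = ker 0 (M.1 0 0) (M.1 0 1) := by
  have hdet := det_eq M
  rw [hc, mul_zero, sub_zero] at hdet
  have ha : M.1 0 0 ≠ 0 := left_ne_zero_of_mul_eq_one hdet
  set a := M.1 0 0
  set b := M.1 0 1
  ext η
  rw [ft]
  set G : ℝ → ℂ := fun s => ((|a| ^ (1 / 2 : ℝ) : ℝ) : ℂ) * (chi s *
    e ((1 / 2) * (b / a) * s ^ 2 - η / a * s)) with hG
  have h1 : (fun t => weil M t * e (-(t * η))) = fun t => G (a * t) := by
    ext t
    rw [weil_eq_chi hc, mul_assoc, mul_assoc, ← e_add]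
    simp only [hG]
    congr 3
    change (1 / 2) * (a * b) * t ^ 2 + -(t * η) = _
    field_simp
    ring
  rw [h1, Measure.integral_comp_mul_left, hG, integral_const_mul, ker, osc,
    intervalIntegral.integral_of_le zero_le_one, ← integral_indicator measurableSet_Ioc]
  have h2 : ∀ s, chi s * e ((1 / 2) * (b / a) * s ^ 2 - η / a * s) = (Set.Ioc (0 : ℝ) 1).indicator
      (fun t => e ((1 / 2) * (b / a) * t ^ 2 - η / a * t + (1 / 2) * 0 * η ^ 2 / a)) s := by
    intro s
    by_cases hs : s ∈ Set.Ioc (0 : ℝ) 1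
    · simp [chi, Set.indicator_of_mem hs]
    · simp [chi, Set.indicator_of_notMem hs]
  simp_rw [h2]
  rw [← Complex.coe_smul, smul_eq_mul, ← mul_assoc, ← Complex.ofReal_mul, abs_inv]
  congr 2
  rw [← Real.rpow_neg_one, ← Real.rpow_add (abs_pos.mpr ha)]
  norm_num

/-! ### Invariance under `SL(2,ℤ)` -/

/-- The inclusion of `SL(2,ℤ)` in `SL(2,ℝ)`. -/
def toG : SL(2, ℤ) →* SL(2, ℝ) := Matrix.SpecialLinearGroup.map (n := Fin 2) (Int.castRingHom ℝ)

section Entries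

variable (M : SL(2, ℝ))

theorem toG_S_mul : (toG ModularGroup.S * M).1 = !![-M.1 1 0, -M.1 1 1; M.1 0 0, M.1 0 1] := by
  have : (toG ModularGroup.S).1 = !![0, -1; 1, 0] := by
    ext i j
    change ((ModularGroup.S.1 i j : ℤ) : ℝ) = _
    fin_cases i <;> fin_cases j <;> simp [ModularGroup.S]
  rw [Matrix.SpecialLinearGroup.coe_mul, this]
  ext i j
  fin_cases i <;> fin_cases j <;> simp [Matrix.mul_apply, Fin.sum_univ_two]

theorem toG_T_mul : (toG ModularGroup.T * M).1 =
    !![M.1 0 0 + M.1 1 0, M.1 0 1 + M.1 1 1; M.1 1 0, M.1 1 1] := by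
  have : (toG ModularGroup.T).1 = !![1, 1; 0, 1] := by
    ext i j
    change ((ModularGroup.T.1 i j : ℤ) : ℝ) = _
    fin_cases i <;> fin_cases j <;> simp [ModularGroup.T]
  rw [Matrix.SpecialLinearGroup.coe_mul, this]
  ext i j
  fin_cases i <;> fin_cases j <;> simp [Matrix.mul_apply, Fin.sum_univ_two]

end Entries

theorem law_zak_congr {g h : ℝ → ℂ} (hg : SqInt g) (hh : SqInt h) (hgh : g = h) :
    law hg.zak = law hh.zak := by
  subst hgh
  rfl

theorem nuG_T_mul (M : SL(2, ℝ)) : nuG (toG ModularGroup.T * M) = nuG M := by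
  rw [nuG_eq_law, nuG_eq_law]
  refine law_zak_chirp _ _ fun w => ?_
  have hM := toG_T_mul M
  have hr := row_pos M
  have hv : iwV (toG ModularGroup.T * M) = iwV M := by
    simp [iwV, hM]
  have hphi : iwPhi (toG ModularGroup.T * M) = iwPhi M := by
    simp [iwPhi, hM]
  have hu : iwU (toG ModularGroup.T * M) = iwU M + 1 := by
    simp only [iwU, hM]
    simp
    field_simp
    ring
  rw [weil, weil, hv, hphi, hu, mul_add, e_add, mul_one]
  ring

theorem nuG_S_mul_of_ne_zero {M : SL(2, ℝ)} (ha : M.1 0 0 ≠ 0) (hc : M.1 1 0 ≠ 0) :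
    nuG (toG ModularGroup.S * M) = nuG M := by
  rw [nuG_eq_law, nuG_eq_law]
  have hM := toG_S_mul M
  have h1 : weil (toG ModularGroup.S * M) = ker (-M.1 1 0) (M.1 0 0) (M.1 0 1) := by
    ext w
    rw [weil_eq_ker (by simpa [hM] using ha)]
    simp [hM]
  rw [law_zak_congr _ (sqInt_ker ha) h1, law_zak_congr (sqInt_weil M) (sqInt_ker hc)
    (funext (weil_eq_ker hc))]
  exact law_zak_ker ha hc (det_eq M)

theorem nuG_S_mul_of_eq_zero {M : SL(2, ℝ)} (hc : M.1 1 0 = 0) :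
    nuG (toG ModularGroup.S * M) = nuG M := by
  rw [nuG_eq_law, nuG_eq_law]
  have hM := toG_S_mul M
  have hdet := det_eq M
  rw [hc, mul_zero, sub_zero] at hdet
  have ha : M.1 0 0 ≠ 0 := left_ne_zero_of_mul_eq_one hdet
  have h1 : weil (toG ModularGroup.S * M) = ft (weil M) := by
    ext w
    rw [weil_eq_ker (by simpa [hM] using ha), ft_weil hc]
    simp [hM, hc]
  rw [law_zak_congr _ (decay_weil hc).sqInt_ft h1, (decay_weil hc).law_zak_ft]

theorem nuG_S_mul (M : SL(2, ℝ)) : nuG (toG ModularGroup.S * M) = nuG M := by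
  by_cases hc : M.1 1 0 = 0
  · exact nuG_S_mul_of_eq_zero hc
  by_cases ha : M.1 0 0 = 0
  swap
  · exact nuG_S_mul_of_ne_zero ha hc
  -- In the remaining case a = 0 ≠ c, the matrix SM has lower left entry 0, so a second S is allowed
  -- and leads to S² M = -M. It remains to compare M with -M. Both are moved by T, which makes the
  -- entries of the first column nonzero, and then S² is applied in the generic case.
  have hneg : ∀ N : SL(2, ℝ), toG ModularGroup.S * (toG ModularGroup.S * N) = -N := by
    intro N
    ext i j
    rw [toG_S_mul, toG_S_mul]
    fin_cases i <;> fin_cases j <;> simp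
  have h1 : nuG (toG ModularGroup.S * M) = nuG (-M) := by
    rw [← hneg, nuG_S_mul_of_eq_zero (M := toG ModularGroup.S * M)]
    simp [toG_S_mul, ha, -Matrix.SpecialLinearGroup.coe_mul]
  have hT := toG_T_mul M
  rw [h1, ← nuG_T_mul M, ← nuG_T_mul (-M), mul_neg, ← hneg,
    nuG_S_mul_of_ne_zero (M := toG ModularGroup.S * (toG ModularGroup.T * M)),
    nuG_S_mul_of_ne_zero (M := toG ModularGroup.T * M)]
  all_goals simp [toG_S_mul, hT, ha, hc, -Matrix.SpecialLinearGroup.coe_mul]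

theorem nuG_toG_mul (γ : SL(2, ℤ)) : ∀ M : SL(2, ℝ), nuG (toG γ * M) = nuG M := by
  have hγ : γ ∈ Subgroup.closure {ModularGroup.S, ModularGroup.T} := by
    rw [SpecialLinearGroup.SL2Z_generators]
    trivial
  induction hγ using Subgroup.closure_induction with
  | mem x hx =>
    rcases hx with rfl | rfl
    · exact nuG_S_mul
    · exact nuG_T_mul
  | one => intro M; rw [map_one, one_mul]
  | mul x y _ _ hx hy => intro M; rw [map_mul, mul_assoc, hx, hy]
  | inv x _ hx => intro M; rw [← hx, ← mul_assoc, ← map_mul, mul_inv_cancel, map_one, one_mul]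

/-! ### Continuity -/

instance : FirstCountableTopology SL(2, ℝ) :=
  haveI : FirstCountableTopology (Matrix (Fin 2) (Fin 2) ℝ) :=
    inferInstanceAs (FirstCountableTopology (Fin 2 → Fin 2 → ℝ))
  Topology.IsInducing.subtypeVal.firstCountableTopology

theorem continuous_entry (i j : Fin 2) : Continuous fun M : SL(2, ℝ) => M.1 i j :=
  continuous_subtype_val.matrix_elem i j

/-- Near M the entry c stays away from 0, so the kernels have a common square integrable majorant
and converge pointwise, hence in L². -/
theorem continuousAt_nuG_of_ne_zero {M : SL(2, ℝ)} (hc : M.1 1 0 ≠ 0) : ContinuousAt nuG M := by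
  have hcont : ∀ i j, Tendsto (fun N : SL(2, ℝ) => N.1 i j) (𝓝 M) (𝓝 (M.1 i j)) :=
    fun i j => (continuous_entry i j).tendsto M
  set A : ℝ := 2 + |M.1 1 0| + |M.1 1 1| with hA
  have hc0 : 0 < |M.1 1 0| := abs_pos.mpr hc
  have hd0 : 0 ≤ |M.1 1 1| := abs_nonneg _
  have e1 : ∀ᶠ N : SL(2, ℝ) in 𝓝 M, |M.1 1 0| / 2 < |N.1 1 0| :=
    (hcont 1 0).abs.eventually (lt_mem_nhds (by linarith))
  have e2 : ∀ᶠ N : SL(2, ℝ) in 𝓝 M, |N.1 1 0| < A :=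
    (hcont 1 0).abs.eventually (gt_mem_nhds (by linarith))
  have e3 : ∀ᶠ N : SL(2, ℝ) in 𝓝 M, |N.1 1 1| < A :=
    (hcont 1 1).abs.eventually (gt_mem_nhds (by linarith))
  have hb : ∀ᶠ N : SL(2, ℝ) in 𝓝 M, ∀ w, ‖weil N w‖ ^ 2 ≤
      (2 * A + (1 + 4 * A ^ 2) / (|M.1 1 0| / 2)) * (1 + w ^ 2)⁻¹ := by
    filter_upwards [e1, e2, e3] with N h1 h2 h3 w
    rw [weil_eq_ker (abs_pos.mp (by linarith))]
    exact norm_ker_sq_le_of_bounds (by linarith) (by linarith) h1.le h2.le h3.le w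
  rw [ContinuousAt, funext nuG_eq_law]
  refine tendsto_law (SqInt.tendsto_zak sqInt_weil (sqInt_weil M) ?_)
  refine tendsto_lintegral_sub_of_dominated (Eventually.of_forall measurable_weil) hb
    hb.self_of_nhds (measurable_weil M) fun w => ?_
  have h4 : Tendsto (fun N : SL(2, ℝ) => (N.1 0 0, N.1 1 0, N.1 1 1)) (𝓝 M)
      (𝓝 (M.1 0 0, M.1 1 0, M.1 1 1)) :=
    (hcont 0 0).prodMk_nhds ((hcont 1 0).prodMk_nhds (hcont 1 1))
  rw [weil_eq_ker hc]
  refine ((continuousAt_ker hc w).tendsto.comp h4).congr' ?_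
  filter_upwards [e1] with N h1
  rw [weil_eq_ker (abs_pos.mp (by linarith))]
  rfl

/-- The kernel bounds degenerate at c = 0. There a ≠ 0 is the lower left entry of SM, and the law is
the same. -/
theorem continuous_nuG : Continuous nuG := by
  refine continuous_iff_continuousAt.mpr fun M => ?_
  by_cases hc : M.1 1 0 = 0
  · have ha : (toG ModularGroup.S * M).1 1 0 ≠ 0 := by
      have hdet := det_eq M
      rw [hc, mul_zero, sub_zero] at hdet
      simpa [toG_S_mul, -Matrix.SpecialLinearGroup.coe_mul] using left_ne_zero_of_mul_eq_one hdet
    have h1 := continuousAt_nuG_of_ne_zero ha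
    have h2 : Continuous fun N : SL(2, ℝ) => toG ModularGroup.S * N := continuous_const_mul _
    exact (h1.comp h2.continuousAt).congr (Eventually.of_forall fun N => nuG_S_mul N)
  · exact continuousAt_nuG_of_ne_zero hc

/-! ### Escape into the cusp -/

/-- The quantity v^{-1/2} is the length of the bottom row, so it bounds both |c| and |d|. For c ≠ 0
this is the oscillatory tail bound; for c = 0 the relation |a||d| = 1 puts aw outside the support of
χ. -/
theorem norm_weil_sq_le_tail (M : SL(2, ℝ)) {w : ℝ} (hw : 2 * Real.sqrt (iwV M)⁻¹ ≤ |w|) :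
    ‖weil M w‖ ^ 2 ≤ Real.sqrt (iwV M)⁻¹ / w ^ 2 := by
  have hv : (iwV M)⁻¹ = M.1 1 0 ^ 2 + M.1 1 1 ^ 2 := by rw [iwV, one_div, inv_inv]
  set ρ := Real.sqrt (iwV M)⁻¹ with hρ
  have hc : |M.1 1 0| ≤ ρ := by
    rw [hρ, hv]
    exact Real.abs_le_sqrt (by nlinarith [sq_nonneg (M.1 1 1)])
  have hd : |M.1 1 1| ≤ ρ := by
    rw [hρ, hv]
    exact Real.abs_le_sqrt (by nlinarith [sq_nonneg (M.1 1 0)])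
  have hρ0 : 0 < ρ := Real.sqrt_pos.mpr (inv_pos.mpr (iwV_pos M))
  by_cases h : M.1 1 0 = 0
  · have hdet := det_eq M
    rw [h, mul_zero, sub_zero] at hdet
    have : M.1 0 0 * w ∉ Set.Ioc (0 : ℝ) 1 := by
      intro hm
      have h1 : |M.1 0 0 * w| ≤ 1 := abs_le.mpr ⟨by linarith [hm.1], hm.2⟩
      have h2 : |M.1 0 0| * |M.1 1 1| = 1 := by rw [← abs_mul, hdet, abs_one]
      rw [abs_mul] at h1
      have h3 : |M.1 0 0| * (2 * |M.1 1 1|) ≤ |M.1 0 0| * |w| :=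
        mul_le_mul_of_nonneg_left (by linarith) (abs_nonneg _)
      linarith
    rw [weil_eq_chi h, chi, Set.indicator_of_notMem this, mul_zero, zero_mul, norm_zero, zero_pow two_ne_zero]
    positivity
  · rw [weil_eq_ker h]
    refine (norm_ker_sq_le_tail h (abs_pos.mp (by linarith)) (by linarith)).trans ?_
    gcongr

/-- The part of `weil M` away from the origin. -/
def weilTail (M : SL(2, ℝ)) (η : ℝ) : ℝ → ℂ := {w | η ≤ |w|}.indicator (weil M)

theorem measurable_weilTail (M : SL(2, ℝ)) (η : ℝ) : Measurable (weilTail M η) :=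
  (measurable_weil M).indicator (measurableSet_le measurable_const (by fun_prop))

theorem norm_weilTail_sq_le {M : SL(2, ℝ)} {η : ℝ} (hη : 0 < η)
    (h : 2 * Real.sqrt (iwV M)⁻¹ ≤ η) (w : ℝ) :
    ‖weilTail M η w‖ ^ 2 ≤ Real.sqrt (iwV M)⁻¹ * (1 + (η ^ 2)⁻¹) * (1 + w ^ 2)⁻¹ := by
  by_cases hw : η ≤ |w|
  · rw [weilTail, Set.indicator_of_mem (by exact hw)]
    refine (norm_weil_sq_le_tail M (h.trans hw)).trans ?_
    rw [div_eq_mul_inv, mul_assoc]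
    refine mul_le_mul_of_nonneg_left ?_ (Real.sqrt_nonneg _)
    have hw2 : η ^ 2 ≤ w ^ 2 := by
      rw [← sq_abs w]
      exact pow_le_pow_left₀ hη.le hw 2
    have hw0 : 0 < w ^ 2 := lt_of_lt_of_le (by positivity) hw2
    rw [← div_eq_mul_inv, le_div_iff₀ (by positivity), inv_mul_le_iff₀ hw0]
    have : 1 ≤ w ^ 2 * (η ^ 2)⁻¹ := by
      rw [← div_eq_mul_inv, one_le_div (by positivity)]
      exact hw2
    linarith
  · rw [weilTail, Set.indicator_of_notMem (by exact hw), norm_zero, zero_pow two_ne_zero]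
    positivity

theorem sqInt_weilTail {M : SL(2, ℝ)} {η : ℝ} (hη : 0 < η)
    (h : 2 * Real.sqrt (iwV M)⁻¹ ≤ η) : SqInt (weilTail M η) :=
  .of_bound (measurable_weilTail M η) (norm_weilTail_sq_le hη h)

theorem lintegral_weilTail_le {M : SL(2, ℝ)} {η : ℝ} (hη : 0 < η)
    (h : 2 * Real.sqrt (iwV M)⁻¹ ≤ η) : ∫⁻ w, ‖weilTail M η w‖ₑ ^ 2 ≤
      ENNReal.ofReal (Real.sqrt (iwV M)⁻¹ * (1 + (η ^ 2)⁻¹) * Real.pi) := by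
  refine (lintegral_mono fun w => enorm_sq_le_ofReal (norm_weilTail_sq_le hη h w)).trans_eq ?_
  rw [← ofReal_integral_eq_lintegral_ofReal (integrable_inv_one_add_sq.const_mul _)
    (Eventually.of_forall fun w => by positivity), integral_const_mul,
    integral_univ_inv_one_add_sq]

/-- If η < y < 1 - η, every n - y has absolute value at least η, so the values of `weil M` near 0
never enter. -/
theorem zak_weil_eq_tail {M : SL(2, ℝ)} {η : ℝ} (hη : 0 < η)
    (h : 2 * Real.sqrt (iwV M)⁻¹ ≤ η) :
    ∀ᵐ p ∂(unif.prod unif), p.2 ∈ Set.Ioo η (1 - η) →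
      (sqInt_weil M).zak p = (sqInt_weilTail hη h).zak p := by
  have h1 := ((sqInt_weil M).sub (sqInt_weilTail hη h)).zak_ae_eq_of_hasSum (F := fun _ => 0)
    (A := {p | p.2 ∈ Set.Ioo η (1 - η)}) (Eventually.of_forall fun p hp => by
      have hz : ∀ n : ℤ, zakTerm (weil M - weilTail M η) n p = 0 := by
        intro n
        have hn : η ≤ |n - p.2| := by
          have hp1 : η < p.2 := hp.1
          have hp2 : p.2 < 1 - η := hp.2
          rcases le_or_gt n 0 with hn | hn
          · have : (n : ℝ) ≤ 0 := by exact_mod_cast hn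
            rw [le_abs]
            right
            linarith
          · have : (1 : ℝ) ≤ n := by exact_mod_cast hn
            rw [le_abs]
            left
            linarith
        rw [zakTerm, Pi.sub_apply, weilTail, Set.indicator_of_mem (by exact hn), sub_self, zero_mul]
      simp only [hz]
      exact hasSum_zero)
  rw [SqInt.zak_sub (sqInt_weil M) (sqInt_weilTail hη h)] at h1
  filter_upwards [h1, Lp.coeFn_sub (sqInt_weil M).zak (sqInt_weilTail hη h).zak] with p hp1 hp2 hp
  have := hp1 hp
  rw [hp2, Pi.sub_apply, sub_eq_zero] at this
  exact this

theorem unif_compl_Ioo_le {η : ℝ} : unif (Set.Ioo η (1 - η))ᶜ ≤ ENNReal.ofReal (2 * η) := by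
  rw [unif, Measure.restrict_apply measurableSet_Ioo.compl]
  calc volume ((Set.Ioo η (1 - η))ᶜ ∩ Set.Ico 0 1)
      ≤ volume (Set.Icc 0 η ∪ Set.Icc (1 - η) 1) := by
        refine measure_mono fun y hy => ?_
        obtain ⟨h1, h2⟩ := hy
        by_cases h : η < y
        · right
          refine ⟨?_, h2.2.le⟩
          by_contra h3
          exact h1 ⟨h, not_le.mp h3⟩
        · left
          exact ⟨h2.1, not_lt.mp h⟩
    _ ≤ volume (Set.Icc 0 η) + volume (Set.Icc (1 - η) 1) := measure_union_le _ _
    _ = ENNReal.ofReal (2 * η) := by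
        rw [Real.volume_Icc, Real.volume_Icc, sub_zero, sub_sub_cancel, ENNReal.ofReal_mul two_pos.le,
          ← two_mul]
        simp

/-- The first term pays for y near 0 or 1. On the rest the transform is that of the tail, and
Chebyshev's inequality with the isometry gives the second. -/
theorem measure_zak_weil_le {M : SL(2, ℝ)} {η : ℝ} (hη : 0 < η)
    (h : 2 * Real.sqrt (iwV M)⁻¹ ≤ η) {ε : ENNReal} (hε : 0 < ε) (hε' : ε ≠ ⊤) :
    (unif.prod unif) {p | ε ≤ ‖(sqInt_weil M).zak p‖ₑ} ≤ ENNReal.ofReal (2 * η) +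
      ENNReal.ofReal (Real.sqrt (iwV M)⁻¹ * (1 + (η ^ 2)⁻¹) * Real.pi) / ε ^ 2 := by
  set Z := (sqInt_weilTail hη h).zak with hZ
  have hmZ := (Lp.stronglyMeasurable Z).measurable
  calc (unif.prod unif) {p | ε ≤ ‖(sqInt_weil M).zak p‖ₑ}
      ≤ (unif.prod unif) (Prod.snd ⁻¹' (Set.Ioo η (1 - η))ᶜ ∪ {p | ε ^ 2 ≤ ‖Z p‖ₑ ^ 2}) := by
        refine measure_mono_ae ?_
        filter_upwards [zak_weil_eq_tail hη h] with p hp hpε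
        by_cases hA : p.2 ∈ Set.Ioo η (1 - η)
        · right
          have h2 : ε ≤ ‖(sqInt_weil M).zak p‖ₑ := hpε
          rw [hp hA] at h2
          exact pow_le_pow_left' h2 2
        · left
          exact hA
    _ ≤ (unif.prod unif) (Prod.snd ⁻¹' (Set.Ioo η (1 - η))ᶜ) +
          (unif.prod unif) {p | ε ^ 2 ≤ ‖Z p‖ₑ ^ 2} := measure_union_le _ _
    _ ≤ _ := by
        refine add_le_add ?_ ?_
        · rw [(measurePreserving_snd (μ := unif) (ν := unif)).measure_preimage
            measurableSet_Ioo.compl.nullMeasurableSet]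
          exact unif_compl_Ioo_le
        · refine (meas_ge_le_lintegral_div (hmZ.enorm.pow_const 2).aemeasurable
            (ENNReal.pow_pos hε 2).ne' (ENNReal.pow_ne_top hε')).trans ?_
          gcongr
          rw [← enorm_sq_Lp, hZ, SqInt.enorm_zak]
          exact lintegral_weilTail_le hη h

theorem exists_iwV_eq {v : ℝ} (hv : 0 < v) : ∃ M : SL(2, ℝ), iwV M = v := by
  have hs := Real.sqrt_pos.mpr hv
  refine ⟨⟨!![Real.sqrt v, 0; 0, (Real.sqrt v)⁻¹], ?_⟩, ?_⟩
  · rw [Matrix.det_fin_two_of]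
    field_simp
    ring
  · simp [iwV, Real.sq_sqrt hv.le]

/-- The filter of v → ∞ must be proper for δ₀ to be in the closure of the laws. -/
instance neBot_comap_iwV : (comap iwV atTop).NeBot := by
  rw [comap_neBot_iff]
  intro s hs
  obtain ⟨v, hv⟩ := mem_atTop_sets.mp hs
  obtain ⟨M, hM⟩ := exists_iwV_eq (v := max v 1) (by positivity)
  exact ⟨M, hM ▸ hv _ (le_max_left _ _)⟩

/-- First η is fixed so that the excluded strips are small; then v → ∞ makes the tail term vanish
for that η. -/
theorem tendsto_nuG_cusp : Tendsto nuG (comap iwV atTop) (𝓝 delta0) := by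
  rw [← law_zero]
  simp_rw [funext nuG_eq_law]
  refine tendsto_law_of_tendstoInMeasure (tendstoInMeasure_of_ne_top fun ε hε hε' => ?_)
  have hv : Tendsto iwV (comap iwV atTop) atTop := tendsto_comap
  have hinv : Tendsto (fun M => (iwV M)⁻¹) (comap iwV atTop) (𝓝 0) := tendsto_inv_atTop_zero.comp hv
  have hρ : Tendsto (fun M => Real.sqrt (iwV M)⁻¹) (comap iwV atTop) (𝓝 0) := by
    simpa [Function.comp_def] using (Real.continuous_sqrt.tendsto 0).comp hinv
  rw [ENNReal.tendsto_nhds_zero]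
  intro δ hδ
  obtain ⟨η, hη, hηδ⟩ : ∃ η : ℝ, 0 < η ∧ ENNReal.ofReal (2 * η) < δ := by
    have : Tendsto (fun η : ℝ => ENNReal.ofReal (2 * η)) (𝓝[>] 0) (𝓝 0) := by
      have h0 : Continuous fun η : ℝ => ENNReal.ofReal (2 * η) :=
        ENNReal.continuous_ofReal.comp (by fun_prop)
      simpa using (h0.tendsto 0).mono_left nhdsWithin_le_nhds
    obtain ⟨η, h1, h2⟩ := ((this.eventually (gt_mem_nhds hδ)).and self_mem_nhdsWithin).exists
    exact ⟨η, h2, h1⟩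
  have hlim : Tendsto (fun M => ENNReal.ofReal (2 * η) +
      ENNReal.ofReal (Real.sqrt (iwV M)⁻¹ * (1 + (η ^ 2)⁻¹) * Real.pi) / ε ^ 2)
      (comap iwV atTop) (𝓝 (ENNReal.ofReal (2 * η))) := by
    have h1 : Tendsto (fun M => ENNReal.ofReal (Real.sqrt (iwV M)⁻¹ * (1 + (η ^ 2)⁻¹) * Real.pi))
        (comap iwV atTop) (𝓝 0) := by
      have h2 := (hρ.mul_const (1 + (η ^ 2)⁻¹)).mul_const Real.pi
      simpa using ENNReal.tendsto_ofReal h2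
    have h3 := (ENNReal.Tendsto.div_const h1 (Or.inr (ENNReal.pow_pos hε 2).ne')).const_add
      (ENNReal.ofReal (2 * η))
    simpa using h3
  have h2ρ : ∀ᶠ M in comap iwV atTop, 2 * Real.sqrt (iwV M)⁻¹ ≤ η := by
    filter_upwards [hρ.eventually (gt_mem_nhds (show (0 : ℝ) < η / 2 by positivity))] with M hM
    linarith
  filter_upwards [h2ρ, hlim.eventually (gt_mem_nhds hηδ)] with M h1 h2
  refine le_trans ?_ ((measure_zak_weil_le hη h1 hε hε').trans h2.le)
  refine measure_mono_ae ?_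
  filter_upwards [Lp.coeFn_zero ℂ 2 (unif.prod unif)] with p hp hpε
  have h3 : ε ≤ edist ((sqInt_weil M).zak p) ((0 : Lp ℂ 2 (unif.prod unif)) p) := hpε
  rw [hp, Pi.zero_apply, edist_zero_right] at h3
  exact h3

/-! ### Reduction theory -/

/-- This links the Iwasawa coordinates to the action on the upper half plane, where the fundamental
domain of SL(2,ℤ) is available. -/
theorem coe_smul_I (M : SL(2, ℝ)) :
    ((M • UpperHalfPlane.I : UpperHalfPlane) : ℂ) = iwU M + iwV M * Complex.I := by
  have hdet := det_eq M
  have hr := row_pos M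
  have hne : (M.1 1 0 : ℂ) * Complex.I + M.1 1 1 ≠ 0 := by
    intro h
    have h1 := congrArg Complex.re h
    have h2 := congrArg Complex.im h
    simp at h1 h2
    simp [h1, h2] at hr
  have hr' : ((M.1 1 0 : ℂ) ^ 2 + (M.1 1 1 : ℂ) ^ 2) ≠ 0 := by exact_mod_cast hr.ne'
  have hdet' : (M.1 0 0 : ℂ) * M.1 1 1 - M.1 0 1 * M.1 1 0 = 1 := by exact_mod_cast hdet
  rw [UpperHalfPlane.coe_specialLinearGroup_apply, UpperHalfPlane.coe_I]
  simp only [Algebra.algebraMap_self, RingHom.id_apply]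
  rw [div_eq_iff hne, iwU, iwV]
  push_cast
  field_simp
  ring_nf
  simp only [Complex.I_sq]
  linear_combination ((M.1 1 1 : ℂ) * Complex.I - M.1 1 0) * hdet'

theorem toG_mul_smul (γ : SL(2, ℤ)) (M : SL(2, ℝ)) (z : UpperHalfPlane) :
    (toG γ * M) • z = γ • (M • z) := by
  rw [mul_smul]
  generalize M • z = w
  ext
  rw [UpperHalfPlane.coe_specialLinearGroup_apply (toG γ) w,
    UpperHalfPlane.coe_specialLinearGroup_apply γ w]
  rfl

/-- In the standard fundamental domain the imaginary part is at least √3/2; the cruder 1/2 is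
enough. -/
theorem exists_toG_mul_siegel (M : SL(2, ℝ)) :
    ∃ γ : SL(2, ℤ), |iwU (toG γ * M)| ≤ 1 / 2 ∧ 1 / 2 ≤ iwV (toG γ * M) := by
  obtain ⟨γ, hγ⟩ := ModularGroup.exists_smul_mem_fd (M • UpperHalfPlane.I)
  have h := coe_smul_I (toG γ * M)
  rw [toG_mul_smul] at h
  have hre := congrArg Complex.re h
  have him := congrArg Complex.im h
  simp only [Complex.add_re, Complex.add_im, Complex.ofReal_re, Complex.ofReal_im, Complex.mul_re,
    Complex.mul_im, Complex.I_re, Complex.I_im, mul_zero, mul_one, sub_zero, add_zero,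
    zero_add] at hre him
  have h3 := ModularGroup.three_le_four_mul_im_sq_of_mem_fd hγ
  refine ⟨γ, ?_, ?_⟩
  · rw [← hre]
    exact hγ.2
  · have hpos := iwV_pos (toG γ * M)
    rw [← UpperHalfPlane.coe_im, him] at h3
    nlinarith

/-- Matrices with entries bounded by `B`. -/
def boundedSL (B : ℝ) : Set SL(2, ℝ) := {M | ∀ i j, M.1 i j ∈ Set.Icc (-B) B}

theorem isCompact_boundedSL (B : ℝ) : IsCompact (boundedSL B) := by
  have hcl : IsClosed {A : Matrix (Fin 2) (Fin 2) ℝ | A.det = 1} :=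
    isClosed_eq (Continuous.matrix_det continuous_id) continuous_const
  have hK : IsCompact (Set.univ.pi fun _ : Fin 2 => Set.univ.pi fun _ : Fin 2 => Set.Icc (-B) B) :=
    isCompact_univ_pi fun _ => isCompact_univ_pi fun _ => isCompact_Icc
  have h := hcl.isClosedEmbedding_subtypeVal.isCompact_preimage hK
  have he : boundedSL B = (Subtype.val : SL(2, ℝ) → Matrix (Fin 2) (Fin 2) ℝ) ⁻¹'
      (Set.univ.pi fun _ : Fin 2 => Set.univ.pi fun _ : Fin 2 => Set.Icc (-B) B) := by
    ext M
    exact ⟨fun h i _ j _ => h i j, fun h i j => h i trivial j trivial⟩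
  rw [he]
  exact h

/-- The bottom row has squared length 1/v ≤ 2. Lagrange's identity with determinant 1 gives squared
length (u² + v²)/v for the top row. -/
theorem mem_boundedSL {M : SL(2, ℝ)} {R : ℝ} (hu : |iwU M| ≤ 1 / 2) (hv : 1 / 2 ≤ iwV M)
    (hR : iwV M ≤ R) : M ∈ boundedSL (2 + 2 * R) := by
  have hdet := det_eq M
  have hr := row_pos M
  set r := M.1 1 0 ^ 2 + M.1 1 1 ^ 2 with hrdef
  have hvr : iwV M * r = 1 := by
    rw [iwV, ← hrdef]
    field_simp
  have hur : iwU M * r = M.1 0 0 * M.1 1 0 + M.1 0 1 * M.1 1 1 := by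
    rw [iwU, ← hrdef]
    field_simp
  have htop : M.1 0 0 ^ 2 + M.1 0 1 ^ 2 = (iwU M ^ 2 + iwV M ^ 2) * r := by
    have : (M.1 0 0 ^ 2 + M.1 0 1 ^ 2) * r = (iwU M ^ 2 + iwV M ^ 2) * r * r := by
      have h1 : (M.1 0 0 ^ 2 + M.1 0 1 ^ 2) * r =
          (M.1 0 0 * M.1 1 0 + M.1 0 1 * M.1 1 1) ^ 2 + (M.1 0 0 * M.1 1 1 - M.1 0 1 * M.1 1 0) ^ 2 := by
        rw [hrdef]
        ring
      rw [h1, hdet, ← hur, ← hvr]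
      ring
    exact mul_right_cancel₀ hr.ne' this
  have hr2 : r ≤ 2 := by nlinarith
  have hu2 : iwU M ^ 2 ≤ 1 := by
    rw [← sq_abs]
    nlinarith [abs_nonneg (iwU M)]
  have hv2 : iwV M ^ 2 ≤ R ^ 2 := pow_le_pow_left₀ (by linarith) hR 2
  have htop' : M.1 0 0 ^ 2 + M.1 0 1 ^ 2 ≤ (2 + 2 * R) ^ 2 := by
    rw [htop]
    calc (iwU M ^ 2 + iwV M ^ 2) * r ≤ (1 + R ^ 2) * 2 := by gcongr
      _ ≤ _ := by nlinarith
  have hbot : M.1 1 0 ^ 2 + M.1 1 1 ^ 2 ≤ (2 + 2 * R) ^ 2 := by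
    rw [← hrdef]
    nlinarith
  intro i j
  rw [Set.mem_Icc, ← abs_le]
  refine abs_le_of_sq_le_sq ?_ (by linarith)
  fin_cases i <;> fin_cases j
  · exact le_trans (le_add_of_nonneg_right (sq_nonneg _)) htop'
  · exact le_trans (le_add_of_nonneg_left (sq_nonneg _)) htop'
  · exact le_trans (le_add_of_nonneg_right (sq_nonneg _)) hbot
  · exact le_trans (le_add_of_nonneg_left (sq_nonneg _)) hbot

/-! ### The family of laws on `Γ \ G` -/

theorem toQuot_toG_mul (γ : SL(2, ℤ)) (M : SL(2, ℝ)) : toQuot (toG γ * M) = toQuot M := by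
  refine Quotient.sound ?_
  change QuotientGroup.rightRel Gam _ _
  rw [QuotientGroup.rightRel_apply, mul_inv_rev, ← mul_assoc, mul_inv_cancel, one_mul, ← map_inv]
  exact ⟨γ⁻¹, rfl⟩

/-- `ν_M` as a function of the coset of `M`. -/
def nuQ : ModQuot → ProbabilityMeasure ℂ :=
  Quotient.lift nuG fun M N h => by
    have h' : QuotientGroup.rightRel Gam M N := h
    rw [QuotientGroup.rightRel_apply] at h'
    obtain ⟨γ, hγ⟩ := h'
    have : N = toG γ * M := by
      rw [toG, hγ, inv_mul_cancel_right]
    rw [this, nuG_toG_mul]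

theorem nuQ_toQuot (M : SL(2, ℝ)) : nuQ (toQuot M) = nuG M := rfl

theorem continuous_nuQ : Continuous nuQ := continuous_nuG.quotient_lift _

theorem continuous_toQuot : Continuous toQuot := continuous_quotient_mk'

/-- Every coset has a Siegel representative. Those with v ≤ R form part of a compact set, and for R
large the others have laws in the given neighbourhood of δ₀. -/
theorem tendsto_nuQ_cocompact : Tendsto nuQ (cocompact ModQuot) (𝓝 delta0) := by
  intro W hW
  obtain ⟨s, hs, hsW⟩ := mem_comap.mp (tendsto_nuG_cusp hW)
  obtain ⟨R, hR⟩ := mem_atTop_sets.mp hs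
  refine mem_cocompact.mpr ⟨toQuot '' boundedSL (2 + 2 * R),
    (isCompact_boundedSL _).image continuous_toQuot, fun q hq => ?_⟩
  obtain ⟨M, rfl⟩ : ∃ M, toQuot M = q := Quotient.exists_rep q
  obtain ⟨γ, hu, hv⟩ := exists_toG_mul_siegel M
  rw [← toQuot_toG_mul γ] at hq ⊢
  rcases le_total (iwV (toG γ * M)) R with h | h
  · exact absurd ⟨_, mem_boundedSL hu hv h, rfl⟩ hq
  · exact hsW (hR _ h)

theorem closure_range_nuQ : closure (Set.range nuQ) = Set.range nuQ ∪ {delta0} := by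
  refine Set.Subset.antisymm (fun μ hμ => ?_) (Set.union_subset subset_closure ?_)
  · have : (comap nuQ (𝓝 μ)).NeBot := comap_neBot_iff.mpr fun t ht => by
      obtain ⟨_, h1, q, rfl⟩ := mem_closure_iff_nhds.mp hμ t ht
      exact ⟨q, h1⟩
    -- A point of the closure is a limit of laws along an ultrafilter on Γ \ G. If the ultrafilter
    -- contains a compact set it converges, and continuity identifies the limit as some ν_q;
    -- otherwise it contains the complement of every compact set.
    set u := Ultrafilter.of (comap nuQ (𝓝 μ))
    have hμ : Tendsto nuQ u (𝓝 μ) := tendsto_comap.mono_left (Ultrafilter.of_le _)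
    by_cases h : ∃ K ∈ u, IsCompact K
    · obtain ⟨K, hK, hKc⟩ := h
      obtain ⟨q, -, hq⟩ := hKc.ultrafilter_le_nhds u (le_principal_iff.mpr hK)
      left
      exact ⟨q, tendsto_nhds_unique ((continuous_nuQ.tendsto q).mono_left hq) hμ⟩
    · right
      have hle : (u : Filter ModQuot) ≤ cocompact ModQuot := by
        intro s hs
        obtain ⟨K, hK, hKs⟩ := mem_cocompact.mp hs
        have hKu : Kᶜ ∈ u := by
          rw [Ultrafilter.compl_mem_iff_notMem]
          exact fun hKu => h ⟨K, hKu, hK⟩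
        exact mem_of_superset hKu hKs
      exact tendsto_nhds_unique hμ (tendsto_nuQ_cocompact.mono_left hle)
  · rw [Set.singleton_subset_iff]
    exact mem_closure_of_tendsto tendsto_nuG_cusp
      (Eventually.of_forall fun M => ⟨toQuot M, nuQ_toQuot M⟩)

end ThetaLaw
end

theorem mainTheorem4 :
    -- the theta series of the indicator function of `(0,1]` converges in `L²(𝕋²)`
    (∀ M : SL(2, ℝ), Summable (ThetaLaw.thetaTermLp M)) ∧
    -- `ν_M` depends only on the class of `M` in `Γ \ G`
    ∃ ν : ThetaLaw.ModQuot → ProbabilityMeasure ℂ,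
      (∀ M : SL(2, ℝ), ν (ThetaLaw.toQuot M) = ThetaLaw.nuG M) ∧
      closure (Set.range ν) = Set.range ν ∪ {ThetaLaw.delta0} ∧
      ∀ M : ℕ → ThetaLaw.ModQuot,
        (∀ K : Set ThetaLaw.ModQuot, IsCompact K → ∃ i₀ : ℕ, ∀ i ≥ i₀, M i ∉ K) →
          Tendsto (fun i => ν (M i)) atTop (𝓝 ThetaLaw.delta0) := by
  refine ⟨fun M => ?_, ThetaLaw.nuQ, ThetaLaw.nuQ_toQuot, ThetaLaw.closure_range_nuQ,
    fun M hM => ThetaLaw.tendsto_nuQ_cocompact.comp fun s hs => ?_⟩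
  · rw [ThetaLaw.thetaTermLp_eq]
    exact (ThetaLaw.sqInt_weil M).summable_zakTermLp
  · obtain ⟨K, hK, hKs⟩ := mem_cocompact.mp hs
    obtain ⟨i₀, hi₀⟩ := hM K hK
    exact mem_atTop_sets.mpr ⟨i₀, fun i hi => hKs (hi₀ i hi)⟩
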